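/- Let $\mathcal X,\mathcal Y$ be complex Banach spaces, $\sigma\ge 0$, $\mathbb C_\sigma:=\{s\in\mathbb C:\operatorname{Re}s>\sigma\}$, and let $K:\mathbb C_\sigma\to L(\mathcal X,\mathcal Y)$ be holomorphic with $\|K(s)\|\le C|s|^{\mu}$ on $\mathbb C_\sigma$ for some $C,\mu\in\mathbb R$. Let $p\in\mathbb N_0$, let $h>0$ satisfy $2\sigma h<1$, and set $t_n:=nh$. **Convolution quadrature weights.** For a square matrix $B$ with spectrum in $\mathbb C_\sigma$ put $K(B):=\frac1{2\pi i}\oint (\lambda-B)^{-1}\otimes K(\lambda)\,d\lambda$, where the integral runs along a positively oriented circle that encircles the spectrum of $B$ and lies, with its interior, in $\mathbb C_\sigma$. **$p$-CQ.** Let $\varphi_0,\dots,\varphi_p$ be any basis of the space $\mathcal P_p$ of real polynomials of degree at most $p$. Define $$\mathbf M_{ij}=\int_0^1\varphi_j\varphi_i,\qquad \mathbf S_{ij}=\int_0^1\varphi_j'\varphi_i+\varphi_j(0)\varphi_i(0),\qquad \boldsymbol\delta(z)=\mathbf M^{-1}\big(\mathbf S-z\,(\varphi_i(0)\varphi_j(1))_{ij}\big),$$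 and $\sum_{n\ge 0}W_nz^n=K(\boldsymbol\delta(z)/h)$. For $u:(0,\infty)\to\mathcal X$ let $\mathcal I_pu$ be the piecewise polynomial of degree at most $p$ on the elements $(t_n,t_{n+1}]$ with $\mathcal I_pu(t_{n+1})=u(t_{n+1})$ and $\int_{t_n}^{t_{n+1}}(\mathcal I_pu-u)\,q=0$ for all polynomials $q$ of degree at most $p-1$ and all $n\in\mathbb N_0$. Then $K(\partial_t^h)u$ is the piecewise polynomial with $(K(\partial_t^h)u)(t_n+h\,\cdot)=\sum_{j=0}^nW_j\,[\mathcal I_pu](t_{n-j}+h\,\cdot)$ on $(0,1]$, where $W_j$ acts on coefficient vectors with respect to $(\varphi_i)_{i=0}^p$. **RadauIIa CQ.** Let $0<\xi_0<\dots<\xi_p=1$ be the right-sided Radau nodes, that is the zeros of $\frac{d^p}{dx^p}\big(x^p(x-1)^{p+1}\big)$, with Lagrange polynomials $\ell_0,\dots,\ell_p$. Let $A_{ij}=\int_0^{\xi_i}\ell_j$ and $b_j=\int_0^1\ell_j$ be the coefficients of the $(p+1)$-stage RadauIIa method, $\Delta(z)=\big(A+\tfrac{z}{1-z}\mathbb 1b^{T}\big)^{-1}$,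 and $\sum_{n\ge0}W_n^{\mathrm{RK}}z^n=K(\Delta(z)/h)$. For $g:(0,\infty)\to\mathcal X$, the RadauIIa convolution quadrature approximation at $t_n+h\xi_i$ is the $i$-th component of $\sum_{j=0}^nW^{\mathrm{RK}}_j\big(g(t_{n-j}+h\xi_k)\big)_{k=0}^p$. **Theorem.** For all $z$ in a neighbourhood of $0$ the spectra of $\boldsymbol\delta(z)/h$ and $\Delta(z)/h$ lie in $\mathbb C_\sigma$, and $K(\boldsymbol\delta(z)/h)$ and $K(\Delta(z)/h)$ are given by convergent power series in $z$, so that both methods are well defined. For every $g:(0,\infty)\to\mathcal X$ let $$\widetilde{\mathcal I}_pg(t_n+h\tau):=\sum_{j=0}^p g(t_n+h\xi_j)\,\ell_j(\tau),\qquad n\in\mathbb N_0,\ \tau\in(0,1],$$ be its Radau interpolant. Then for all $n\in\mathbb N_0$ and $i\in\{0,\dots,p\}$ the value $\big(K(\partial_t^h)\,\widetilde{\mathcal I}_pg\big)(t_n+h\xi_i)$ equals the RadauIIa convolution quadrature approximation of $g$ at $t_n+h\xi_i$. -/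

import Mathlib

open Polynomial Filter Topology

noncomputable section

namespace PCQ

/-! ### Radau nodes and the RadauIIa Runge-Kutta method -/

/-- The polynomial `d^p/dx^p (x^p (x-1)^(p+1))`, whose roots are the `p+1` right-sided Radau
nodes of `(0,1]`. -/
def radauPoly (p : ℕ) : ℝ[X] := derivative^[p] (X ^ p * (X - 1) ^ (p + 1))

theorem isRoot_iterate_derivative_of_dvd {P : ℝ[X]} {a : ℝ} {k m : ℕ} (hk : k < m)
    (h : (X - C a) ^ m ∣ P) : (derivative^[k] P).IsRoot a := by
  rw [← dvd_iff_isRoot]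
  refine dvd_trans (dvd_pow_self _ (by omega : m - k ≠ 0)) ?_
  induction k with
  | zero => simpa using h
  | succ k ih =>
    rw [Function.iterate_succ_apply']
    have := pow_sub_one_dvd_derivative_of_pow_dvd (ih (by omega))
    rwa [Nat.sub_sub] at this

theorem radauPoly_natDegree_le (p : ℕ) : (radauPoly p).natDegree ≤ p + 1 := by
  have h1 : (X ^ p * (X - 1) ^ (p + 1) : ℝ[X]).natDegree ≤ p + (p + 1) := by
    refine natDegree_mul_le_of_le (natDegree_X_pow_le p) ?_
    refine (natDegree_pow_le (p := (X - 1 : ℝ[X])) (n := p + 1)).trans ?_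
    rw [← C_1, natDegree_X_sub_C, mul_one]
  have h2 := natDegree_iterate_derivative (X ^ p * (X - 1) ^ (p + 1) : ℝ[X]) p
  unfold radauPoly
  omega

theorem radauPoly_card_roots (p : ℕ) : (radauPoly p).roots.toFinset.card = p + 1 := by
  refine le_antisymm ((Multiset.toFinset_card_le _).trans
    ((card_roots' _).trans (radauPoly_natDegree_le p))) ?_
  set P : ℝ[X] := X ^ p * (X - 1) ^ (p + 1) with hP
  have hne : ∀ k ≤ p, derivative^[k] P ≠ 0 := by
    intro k hk h0
    have hdeg : P.natDegree = p + (p + 1) := by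
      rw [hP, ← C_1, natDegree_mul (pow_ne_zero _ X_ne_zero)
        (pow_ne_zero _ (X_sub_C_ne_zero 1)), natDegree_X_pow, natDegree_pow, natDegree_X_sub_C,
        mul_one]
    have h1 : (derivative^[k] P).coeff (p + (p + 1) - k) = 0 := by simp [h0]
    rw [coeff_iterate_derivative, Nat.sub_add_cancel (by omega), ← hdeg, coeff_natDegree] at h1
    have h2 : P ≠ 0 := by intro h; rw [h] at hdeg; simp at hdeg
    rcases smul_eq_zero.mp h1 with h | h
    · exact (Nat.descFactorial_pos.mpr (by omega)).ne' h
    · exact h2 (leadingCoeff_eq_zero.mp h)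
  have r0 : ∀ k < p, (derivative^[k] P).IsRoot 0 := fun k hk =>
    isRoot_iterate_derivative_of_dvd hk (by simp [hP])
  have r1 : ∀ k ≤ p, (derivative^[k] P).IsRoot 1 := fun k hk =>
    isRoot_iterate_derivative_of_dvd (Nat.lt_succ_of_le hk) (by simp [hP])
  have mem : ∀ k ≤ p, ∀ a, (derivative^[k] P).IsRoot a →
      a ∈ (derivative^[k] P).roots.toFinset := fun k hk a ha => by
    rw [Multiset.mem_toFinset, mem_roots (hne k hk)]; exact ha
  have key : ∀ k < p, k + 2 ≤ (derivative^[k] P).roots.toFinset.card := by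
    intro k
    induction k with
    | zero =>
      intro hk
      have hsub : ({0, 1} : Finset ℝ) ⊆ (derivative^[0] P).roots.toFinset := by
        intro a ha
        rcases Finset.mem_insert.mp ha with rfl | ha
        · exact mem 0 hk.le _ (r0 0 hk)
        · rw [Finset.mem_singleton.mp ha]; exact mem 0 hk.le _ (r1 0 hk.le)
      have := Finset.card_le_card hsub
      rwa [Finset.card_pair zero_ne_one] at this
    | succ k ih =>
      intro hk
      have h1 := card_roots_toFinset_le_card_roots_derivative_sdiff_roots_succ (derivative^[k] P)
      rw [show derivative (derivative^[k] P) = derivative^[k + 1] P from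
        (Function.iterate_succ_apply' derivative k P).symm] at h1
      have h2 := ih (by omega)
      have hsub : ({0, 1} : Finset ℝ) ⊆ (derivative^[k + 1] P).roots.toFinset ∩
          (derivative^[k] P).roots.toFinset := by
        intro a ha
        rw [Finset.mem_inter]
        rcases Finset.mem_insert.mp ha with rfl | ha
        · exact ⟨mem _ hk.le _ (r0 _ hk), mem _ (by omega) _ (r0 _ (by omega))⟩
        · rw [Finset.mem_singleton.mp ha]
          exact ⟨mem _ hk.le _ (r1 _ hk.le), mem _ (by omega) _ (r1 _ (by omega))⟩
      have h3 := Finset.card_le_card hsub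
      rw [Finset.card_pair zero_ne_one] at h3
      have h4 := Finset.card_sdiff_add_card_inter (derivative^[k + 1] P).roots.toFinset
        (derivative^[k] P).roots.toFinset
      omega
  change p + 1 ≤ (derivative^[p] P).roots.toFinset.card
  rcases p with _ | k
  · exact Finset.card_pos.mpr ⟨1, mem 0 le_rfl _ (r1 0 le_rfl)⟩
  · have h1 := card_roots_toFinset_le_card_roots_derivative_sdiff_roots_succ (derivative^[k] P)
    rw [show derivative (derivative^[k] P) = derivative^[k + 1] P from
        (Function.iterate_succ_apply' derivative k P).symm] at h1
    have h2 := key k (by omega)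
    have hsub : ({1} : Finset ℝ) ⊆ (derivative^[k + 1] P).roots.toFinset ∩
        (derivative^[k] P).roots.toFinset := by
      intro a ha
      rw [Finset.mem_singleton.mp ha, Finset.mem_inter]
      exact ⟨mem _ le_rfl _ (r1 _ le_rfl), mem _ (by omega) _ (r1 _ (by omega))⟩
    have h3 := Finset.card_le_card hsub
    rw [Finset.card_singleton] at h3
    have h4 := Finset.card_sdiff_add_card_inter (derivative^[k + 1] P).roots.toFinset
      (derivative^[k] P).roots.toFinset
    omega

/-- The right-sided Radau nodes `ξ_0 < ξ_1 < … < ξ_p = 1` of `(0,1]`. -/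
def radauNode (p : ℕ) : Fin (p + 1) → ℝ :=
  (radauPoly p).roots.toFinset.orderEmbOfFin (radauPoly_card_roots p)

/-- The Lagrange polynomials `ℓ_0, …, ℓ_p` of the Radau nodes. -/
def radauLagrange (p : ℕ) (j : Fin (p + 1)) : ℝ[X] :=
  Lagrange.basis Finset.univ (radauNode p) j

/-- The Runge-Kutta matrix `a_ij = ∫_0^{ξ_i} ℓ_j` of the `(p+1)`-stage RadauIIa method, the
collocation method at the Radau nodes. -/
def radauA (p : ℕ) : Matrix (Fin (p + 1)) (Fin (p + 1)) ℝ :=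
  Matrix.of fun i j => ∫ τ in (0 : ℝ)..radauNode p i, (radauLagrange p j).eval τ

/-- The weights `b_j = ∫_0^1 ℓ_j` of the RadauIIa method. -/
def radauB (p : ℕ) (j : Fin (p + 1)) : ℝ := ∫ τ in (0 : ℝ)..1, (radauLagrange p j).eval τ

/-- The Runge-Kutta convolution quadrature symbol `Δ(z) = (A + z/(1-z) 𝟙 bᵀ)⁻¹`, for RadauIIa. -/
def rkSymbol (p : ℕ) (z : ℂ) : Matrix (Fin (p + 1)) (Fin (p + 1)) ℂ :=
  (Matrix.of fun i j => (radauA p i j : ℂ) + z / (1 - z) * (radauB p j : ℂ))⁻¹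

/-! ### Discontinuous Galerkin symbol in a basis `φ` of the polynomials of degree at most `p` -/

/-- A basis `φ_0, …, φ_p` of the space of real polynomials of degree at most `p`. -/
abbrev PolyBasis (p : ℕ) := Module.Basis (Fin (p + 1)) ℝ (degreeLT ℝ (p + 1))

/-- `φ_j(τ)`. -/
def bval {p : ℕ} (φ : PolyBasis p) (j : Fin (p + 1)) (τ : ℝ) : ℝ := (φ j : ℝ[X]).eval τ

/-- `M_ij = ∫_0^1 φ_j φ_i`. -/
def massMatrix {p : ℕ} (φ : PolyBasis p) : Matrix (Fin (p + 1)) (Fin (p + 1)) ℝ :=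
  Matrix.of fun i j => ∫ τ in (0 : ℝ)..1, bval φ j τ * bval φ i τ

/-- `S_ij = ∫_0^1 φ_j' φ_i + φ_j(0) φ_i(0)`. -/
def stiffMatrix {p : ℕ} (φ : PolyBasis p) : Matrix (Fin (p + 1)) (Fin (p + 1)) ℝ :=
  Matrix.of fun i j =>
    (∫ τ in (0 : ℝ)..1, (derivative (φ j : ℝ[X])).eval τ * bval φ i τ) + bval φ j 0 * bval φ i 0

/-- `T(0)ᵀ T(1)`, the matrix with entries `φ_i(0) φ_j(1)`. -/
def traceMatrix {p : ℕ} (φ : PolyBasis p) : Matrix (Fin (p + 1)) (Fin (p + 1)) ℝ :=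
  Matrix.of fun i j => bval φ i 0 * bval φ j 1

/-- The symbol `δ(z) = M⁻¹ (S - z T(0)ᵀ T(1))`. -/
def dgSymbol {p : ℕ} (φ : PolyBasis p) (z : ℂ) : Matrix (Fin (p + 1)) (Fin (p + 1)) ℂ :=
  ((massMatrix φ).map (fun x => (x : ℂ)))⁻¹ *
    ((stiffMatrix φ).map (fun x => (x : ℂ)) - z • (traceMatrix φ).map (fun x => (x : ℂ)))

/-! ### Functional calculus and convolution quadrature weights -/

section Calculus

variable {E F : Type*} [NormedAddCommGroup E] [NormedSpace ℂ E]
  [NormedAddCommGroup F] [NormedSpace ℂ F] {m : ℕ}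

/-- The Kronecker product `A ⊗ T`, the operator matrix `(a_ij T)`. -/
def kron (A : Matrix (Fin m) (Fin m) ℂ) (T : E →L[ℂ] F) : (Fin m → E) →L[ℂ] (Fin m → F) :=
  ContinuousLinearMap.pi fun i => ∑ j, A i j • T.comp (ContinuousLinearMap.proj j)

/-- The half plane `ℂ_σ = {z : Re z > σ}`. -/
def halfPlane (σ : ℝ) : Set ℂ := {z | σ < z.re}

/-- The circle with centre `c.1` and radius `c.2` runs in `ℂ_σ`, together with its interior, and
encircles the spectrum of `B`. -/
def Encircles (σ : ℝ) (B : Matrix (Fin m) (Fin m) ℂ) (c : ℂ × ℝ) : Prop :=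
  0 < c.2 ∧ Metric.closedBall c.1 c.2 ⊆ halfPlane σ ∧ spectrum ℂ B ⊆ Metric.ball c.1 c.2

theorem exists_encircles (σ : ℝ) (B : Matrix (Fin m) (Fin m) ℂ)
    (hB : spectrum ℂ B ⊆ halfPlane σ) : ∃ c, Encircles σ B c := by
  have hfin : (spectrum ℂ B).Finite := Matrix.finite_spectrum B
  obtain ⟨M, hM⟩ : ∃ M, ∀ l ∈ spectrum ℂ B, ‖l - σ‖ ^ 2 ≤ M := by
    obtain ⟨M, hM⟩ := (hfin.image fun l : ℂ => ‖l - σ‖ ^ 2).bddAbove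
    exact ⟨M, fun l hl => hM ⟨l, hl, rfl⟩⟩
  obtain ⟨e, he, hE⟩ : ∃ e > 0, ∀ l ∈ spectrum ℂ B, e ≤ l.re - σ := by
    rcases (spectrum ℂ B).eq_empty_or_nonempty with h | h
    · exact ⟨1, one_pos, by simp [h]⟩
    · obtain ⟨a, ha, hmin⟩ := Set.exists_min_image _ (fun l : ℂ => l.re - σ) hfin h
      exact ⟨a.re - σ, sub_pos.mpr (hB ha), hmin⟩
  obtain ⟨N, hN⟩ : ∃ N : ℝ, e < N ∧ M < e * N := by
    refine ⟨max (e + 1) (M / e + 1), lt_max_of_lt_left (by linarith), ?_⟩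
    calc M < e * (M / e + 1) := by rw [mul_add, mul_div_cancel₀ _ he.ne']; linarith
      _ ≤ _ := by gcongr; exact le_max_right _ _
  refine ⟨(((σ + N : ℝ) : ℂ), N - e / 2), by dsimp only; linarith, ?_, ?_⟩
  · intro z hz
    have h1 := (Complex.abs_re_le_norm (z - ((σ + N : ℝ) : ℂ))).trans
      (by simpa [dist_eq_norm] using hz)
    rw [Complex.sub_re, Complex.ofReal_re] at h1
    have := (abs_le.mp h1).1
    change σ < z.re
    linarith
  · intro l hl
    have h1 := hM l hl
    have h2 := hE l hl
    rw [Metric.mem_ball, dist_eq_norm]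
    refine lt_of_pow_lt_pow_left₀ 2 (by dsimp only; linarith) ?_
    rw [← Complex.normSq_eq_norm_sq, Complex.normSq_apply] at h1 ⊢
    simp only [Complex.sub_re, Complex.sub_im, Complex.ofReal_re, Complex.ofReal_im, sub_zero]
      at h1 ⊢
    nlinarith

/-- A circle in `ℂ_σ` that encircles the spectrum of `B`; by `exists_encircles` there is one
whenever the spectrum lies in `ℂ_σ`. -/
def spectralCircle (σ : ℝ) (B : Matrix (Fin m) (Fin m) ℂ) : ℂ × ℝ :=
  Classical.epsilon (Encircles σ B)

/-- The functional calculus `K(B) = (2πi)⁻¹ ∮ (λ - B)⁻¹ ⊗ K(λ) dλ` along a positively oriented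
circle in `ℂ_σ` that encircles the spectrum of `B`. -/
def matFun (σ : ℝ) (K : ℂ → E →L[ℂ] F) (B : Matrix (Fin m) (Fin m) ℂ) :
    (Fin m → E) →L[ℂ] (Fin m → F) :=
  (2 * (Real.pi : ℂ) * Complex.I)⁻¹ •
    ∮ l in C((spectralCircle σ B).1, (spectralCircle σ B).2),
      kron ((l • (1 : Matrix (Fin m) (Fin m) ℂ) - B)⁻¹) (K l)

/-- The function `z ↦ K(D(z)/h)` for a matrix valued symbol `D`. -/
def cqGenerating (σ : ℝ) (K : ℂ → E →L[ℂ] F) (D : ℂ → Matrix (Fin m) (Fin m) ℂ) (h : ℝ) (z : ℂ) :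
    (Fin m → E) →L[ℂ] (Fin m → F) :=
  matFun σ K ((h : ℂ)⁻¹ • D z)

/-- The convolution quadrature weights `W_n`: the Taylor coefficients at `0` of `K(D(z)/h)`. -/
def cqWeight (σ : ℝ) (K : ℂ → E →L[ℂ] F) (D : ℂ → Matrix (Fin m) (Fin m) ℂ) (h : ℝ) (n : ℕ) :
    (Fin m → E) →L[ℂ] (Fin m → F) :=
  (n.factorial : ℂ)⁻¹ • iteratedDeriv n (cqGenerating σ K D h) 0

/-- The weights are well defined: for all `z` near `0` the spectrum of `D(z)/h` lies in `ℂ_σ`, so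
that `K(D(z)/h)` is defined, and `∑ W_n z^n = K(D(z)/h)`. -/
def CQWellPosed (σ : ℝ) (K : ℂ → E →L[ℂ] F) (D : ℂ → Matrix (Fin m) (Fin m) ℂ) (h : ℝ) : Prop :=
  ∀ᶠ z in 𝓝 (0 : ℂ), spectrum ℂ ((h : ℂ)⁻¹ • D z) ⊆ halfPlane σ ∧
    HasSum (fun n : ℕ => z ^ n • cqWeight σ K D h n) (cqGenerating σ K D h z)

/-- The discrete convolution `∑_{j=0}^n W_j G^{n-j}`. -/
def cqConv (σ : ℝ) (K : ℂ → E →L[ℂ] F) (D : ℂ → Matrix (Fin m) (Fin m) ℂ) (h : ℝ)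
    (G : ℕ → Fin m → E) (n : ℕ) : Fin m → F :=
  ∑ j ∈ Finset.range (n + 1), cqWeight σ K D h j (G (n - j))

/-! ### The two convolution quadratures -/

/-- The index `n` of the element `(t_n, t_{n+1}]`, `t_n = n h`, that contains `t > 0`. -/
def elemIndex (h t : ℝ) : ℕ := ⌈t / h⌉₊ - 1

/-- The left-continuous piecewise polynomial `t_n + h τ ↦ ∑_j φ_j(τ) V^n_j`, `τ ∈ (0,1]`. -/
def piecewisePoly {p : ℕ} (φ : PolyBasis p) (h : ℝ) (V : ℕ → Fin (p + 1) → E) (t : ℝ) : E :=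
  ∑ j, (bval φ j (t / h - elemIndex h t) : ℂ) • V (elemIndex h t) j

/-- `c` holds the coefficients, in the basis `φ`, of a polynomial of degree at most `p` which on the
element `(t_n, t_{n+1})`, scaled to `(0,1)`, agrees with `u` at the right end point and has the same
`L²` products as `u` with all polynomials of degree at most `p - 1`. -/
def IsDGInterpCoeff {p : ℕ} (φ : PolyBasis p) (h : ℝ) (u : ℝ → E) (n : ℕ)
    (c : Fin (p + 1) → E) : Prop :=
  ∑ j, (bval φ j 1 : ℂ) • c j = u (n * h + h) ∧
    ∀ q ∈ degreeLT ℝ p,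
      ∫ τ in (0 : ℝ)..1, ((q.eval τ : ℝ) : ℂ) • ∑ j, (bval φ j τ : ℂ) • c j =
        ∫ τ in (0 : ℝ)..1, ((q.eval τ : ℝ) : ℂ) • u (n * h + h * τ)

/-- The coefficients of the projection `𝓘_p u` on the element `(t_n, t_{n+1})`. -/
def dgInterpCoeff {p : ℕ} (φ : PolyBasis p) (h : ℝ) (u : ℝ → E) (n : ℕ) : Fin (p + 1) → E :=
  Classical.epsilon (IsDGInterpCoeff φ h u n)

/-- The `p`-CQ approximation `K(∂_t^h) u`, the piecewise polynomial given on `(t_n, t_{n+1}]` by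
`∑_{j=0}^n W_j [𝓘_p u](t_{n-j} + ·)` with `∑ W_n z^n = K(δ(z)/h)`. -/
def pCQ {p : ℕ} (φ : PolyBasis p) (σ : ℝ) (K : ℂ → E →L[ℂ] F) (h : ℝ) (u : ℝ → E) : ℝ → F :=
  piecewisePoly φ h (cqConv σ K (dgSymbol φ) h (dgInterpCoeff φ h u))

/-- The Radau interpolant, `t_n + h τ ↦ ∑_j g(t_n + h ξ_j) ℓ_j(τ)` for `τ ∈ (0,1]`. -/
def radauInterp (p : ℕ) (h : ℝ) (g : ℝ → E) (t : ℝ) : E :=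
  ∑ j, (((radauLagrange p j).eval (t / h - elemIndex h t) : ℝ) : ℂ) •
    g (elemIndex h t * h + h * radauNode p j)

/-- The RadauIIa convolution quadrature of `g`: the vector, over the stages `i`, of the
approximations at `t_n + h ξ_i`, that is `∑_{j=0}^n W_j (g(t_{n-j} + h ξ_i))_i` with
`∑ W_n z^n = K(Δ(z)/h)`. -/
def radauCQ (p : ℕ) (σ : ℝ) (K : ℂ → E →L[ℂ] F) (h : ℝ) (g : ℝ → E) (n : ℕ) : Fin (p + 1) → F :=
  cqConv σ K (rkSymbol p) h (fun k i => g (k * h + h * radauNode p i)) n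

end Calculus

end PCQ

end

/-!
The two symbols are similar matrices, by a real change of basis that does not depend on `z`. Let
`T = (φ_j(ξ_k))_{kj}` be the matrix that takes coefficients to values at the Radau nodes; then
`Δ(z) = T δ(z) T⁻¹` (`rkSymbol_eq`). The core is the identity `S (T⁻¹ A T) = M`
(`stiffMatrix_mul_collocationMatrix`): the antiderivative of a polynomial of degree at most `p` and
its interpolant at the Radau nodes differ by a polynomial that vanishes at the nodes. It is zero at
the end point `1` and, since the Radau quadrature is exact up to degree `2p`
(`sum_radauB_mul_eval`), orthogonal to all derivatives of test functions, so that integration by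
parts shows that the discontinuous Galerkin form does not see it. The exactness comes from the
orthogonality of the Radau polynomial to the polynomials of degree at most `p - 1`.

The spectrum of `δ(0)` lies in `Re l ≥ 1/2` (`half_le_re_of_mem_spectrum_dgSymbol_zero`). This is
the coercivity of the Radau collocation matrix in the inner product with weights `b_k / ξ_k`
(`radauA_coercive`). Hence the spectrum of `δ(0)/h` lies in `ℂ_σ` if `2 σ h < 1`, and by upper
semicontinuity so does the spectrum of `δ(z)/h` for small `z`.

The entries of the resolvent are rational functions with poles in the spectrum, so that contour
integrals of the resolvent against a holomorphic function are the same for all circles around the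
spectrum (`circleIntegral_invProd_smul_eq`, by partial fractions). For small `z` one fixed circle
can therefore be used in `K(δ(z)/h)`, which makes this function holomorphic near `0` and equal to
the sum of its Taylor series. The functional calculus commutes with similarity (`matFun_conj`), so
the weights satisfy `W_n^RK = (T ⊗ I) W_n (T⁻¹ ⊗ I)` (`cqWeight_conj`).

Finally the Radau interpolant is on each element a polynomial of degree at most `p`, reproduced by
the projection `𝓘_p` (`dgInterpCoeff_radauInterp`), with coefficients `T⁻¹ (g(t_n + h ξ_k))_k`. So
the values at the nodes of the `p`-CQ of the interpolant are
`∑_j T W_j T⁻¹ (g(t_{n-j} + h ξ_k))_k`, the Runge-Kutta convolution quadrature of `g`.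
-/

namespace PCQ

/-! ### Integrals of polynomials over the unit interval -/

/-- The functional `P ↦ ∫_0^1 P` on real polynomials. -/
noncomputable def unitIntegral : ℝ[X] →ₗ[ℝ] ℝ where
  toFun P := ∫ τ in (0 : ℝ)..1, P.eval τ
  map_add' P Q := by
    simp only [eval_add]
    exact intervalIntegral.integral_add (P.continuous.intervalIntegrable _ _)
      (Q.continuous.intervalIntegrable _ _)
  map_smul' c P := by simp

theorem integral_eval_derivative (P : ℝ[X]) (a b : ℝ) :
    ∫ τ in a..b, (derivative P).eval τ = P.eval b - P.eval a :=
  intervalIntegral.integral_eq_sub_of_hasDerivAt (fun x _ => P.hasDerivAt x)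
    ((derivative P).continuous.intervalIntegrable _ _)

theorem unitIntegral_derivative (P : ℝ[X]) :
    unitIntegral (derivative P) = P.eval 1 - P.eval 0 :=
  integral_eval_derivative P 0 1

theorem unitIntegral_derivative_mul (P Q : ℝ[X]) :
    unitIntegral (derivative P * Q) =
      P.eval 1 * Q.eval 1 - P.eval 0 * Q.eval 0 - unitIntegral (P * derivative Q) := by
  have := unitIntegral_derivative (P * Q)
  rw [derivative_mul, map_add, eval_mul, eval_mul] at this
  linarith

theorem unitIntegral_pos {P : ℝ[X]} (hP : P ≠ 0) (h : ∀ x, 0 < x → x ≤ 1 → 0 ≤ P.eval x) :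
    0 < unitIntegral P := by
  obtain ⟨c, hc, hPc⟩ : ∃ c ∈ Set.Ioc (0 : ℝ) 1, P.eval c ≠ 0 := by
    by_contra! hcon
    refine hP (eq_zero_of_infinite_isRoot P ((Set.Ioc_infinite zero_lt_one).mono ?_))
    exact fun x hx => hcon x hx
  exact intervalIntegral.integral_pos zero_lt_one P.continuous.continuousOn
    (fun x hx => h x hx.1 hx.2)
    ⟨c, ⟨hc.1.le, hc.2⟩, lt_of_le_of_ne (h c hc.1 hc.2) (Ne.symm hPc)⟩

theorem eq_zero_of_unitIntegral_mul_self {P : ℝ[X]} (h : unitIntegral (P * P) = 0) : P = 0 := by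
  by_contra hP
  refine (unitIntegral_pos (mul_ne_zero hP hP) fun x _ _ => ?_).ne' h
  rw [eval_mul]; exact mul_self_nonneg _

theorem mul_mem_degreeLT {m n k : ℕ} {P Q : ℝ[X]} (hP : P ∈ degreeLT ℝ m) (hQ : Q ∈ degreeLT ℝ n)
    (h : m + n ≤ k + 1) : P * Q ∈ degreeLT ℝ k := by
  rw [mem_degreeLT] at *
  by_cases h0 : P = 0
  · simp [h0]
  by_cases h1 : Q = 0
  · simp [h1]
  rw [degree_mul]
  rw [degree_eq_natDegree h0] at *
  rw [degree_eq_natDegree h1] at *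
  norm_cast at *
  omega

theorem derivative_mem_degreeLT {n : ℕ} {P : ℝ[X]} (hP : P ∈ degreeLT ℝ (n + 1)) :
    derivative P ∈ degreeLT ℝ n := by
  rw [mem_degreeLT] at *
  by_cases h0 : P = 0
  · simp [h0]
  by_cases h1 : derivative P = 0
  · simp [h1]
  have h2 := degree_derivative_lt h0
  rw [degree_eq_natDegree h0] at hP h2
  rw [degree_eq_natDegree h1] at h2 ⊢
  norm_cast at *
  omega

theorem X_mem_degreeLT : (X : ℝ[X]) ∈ degreeLT ℝ 2 := by
  rw [mem_degreeLT, degree_X]; norm_num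

/-- Every polynomial of degree less than `n` has an antiderivative that vanishes at `0`, which is
`X` times a polynomial of degree less than `n`. -/
theorem exists_derivative_X_mul_eq {n : ℕ} {P : ℝ[X]} (hP : P ∈ degreeLT ℝ n) :
    ∃ a ∈ degreeLT ℝ n, derivative (X * a) = P := by
  refine ⟨∑ i ∈ Finset.range n, monomial i (P.coeff i / (i + 1)), ?_, ?_⟩
  · refine Submodule.sum_mem _ fun i hi => ?_
    rw [mem_degreeLT]
    exact (degree_monomial_le _ _).trans_lt (by exact_mod_cast Finset.mem_range.mp hi)
  · have hsum : P = ∑ i ∈ Finset.range n, monomial i (P.coeff i) := by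
      rcases n with _ | n
      · rw [mem_degreeLT] at hP
        simpa using hP
      · refine P.as_sum_range' _ ?_
        rw [mem_degreeLT] at hP
        by_cases h0 : P = 0
        · simp [h0]
        · exact (natDegree_lt_iff_degree_lt h0).mpr hP
    conv_rhs => rw [hsum]
    rw [Finset.mul_sum, map_sum]
    refine Finset.sum_congr rfl fun i _ => ?_
    rw [X_mul_monomial, derivative_monomial]
    congr 1
    push_cast
    field_simp

theorem unitIntegral_derivative_X_mul_mul_self (a : ℝ[X]) :
    unitIntegral (derivative (X * a) * a) =
      (unitIntegral (a * a) + a.eval 1 * a.eval 1) / 2 := by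
  have h := unitIntegral_derivative (X * (a * a))
  have e : derivative (X * (a * a)) = 2 • (derivative (X * a) * a) - a * a := by
    simp only [derivative_mul, derivative_X]; ring
  rw [e, map_sub, map_nsmul] at h
  simp only [eval_mul, eval_X, nsmul_eq_mul] at h
  push_cast at h
  linarith

/-! ### Radau nodes and Radau quadrature -/

theorem radauPoly_ne_zero (p : ℕ) : radauPoly p ≠ 0 := by
  intro h
  have := radauPoly_card_roots p
  simp [h] at this

theorem radauPoly_degree (p : ℕ) : (radauPoly p).degree = (p + 1 : ℕ) := by
  refine le_antisymm (natDegree_le_iff_degree_le.mp (radauPoly_natDegree_le p)) ?_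
  rw [degree_eq_natDegree (radauPoly_ne_zero p)]
  have := (Multiset.toFinset_card_le _).trans (card_roots' (radauPoly p))
  rw [radauPoly_card_roots] at this
  exact_mod_cast this

/-- The Radau polynomial is orthogonal to the polynomials of degree at most `p - 1`: integrate by
parts `p` times, the boundary terms vanish. -/
theorem unitIntegral_radauPoly_mul (p : ℕ) {q : ℝ[X]} (hq : q ∈ degreeLT ℝ p) :
    unitIntegral (radauPoly p * q) = 0 := by
  have key : ∀ k ≤ p, ∀ q ∈ degreeLT ℝ k,
      unitIntegral (derivative^[k] (X ^ p * (X - 1) ^ (p + 1)) * q) = 0 := by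
    intro k
    induction k with
    | zero =>
      intro _ q hq
      rw [mem_degreeLT] at hq
      have : q = 0 := by simpa using hq
      simp [this]
    | succ k ih =>
      intro hk q hq
      rw [Function.iterate_succ_apply', unitIntegral_derivative_mul]
      have r0 : (derivative^[k] (X ^ p * (X - 1) ^ (p + 1) : ℝ[X])).eval 0 = 0 :=
        isRoot_iterate_derivative_of_dvd (Nat.lt_of_succ_le hk) (by simp)
      have r1 : (derivative^[k] (X ^ p * (X - 1) ^ (p + 1) : ℝ[X])).eval 1 = 0 :=
        isRoot_iterate_derivative_of_dvd (m := p + 1) (by omega) (by simp)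
      rw [r0, r1, ih (by omega)]
      · simp
      · exact derivative_mem_degreeLT hq
  exact key p le_rfl q hq

theorem radauPoly_eval_node (p : ℕ) (i : Fin (p + 1)) : (radauPoly p).eval (radauNode p i) = 0 := by
  have h : radauNode p i ∈ (radauPoly p).roots.toFinset := Finset.orderEmbOfFin_mem _ _ _
  rw [Multiset.mem_toFinset] at h
  exact isRoot_of_mem_roots h

theorem radauNode_injective (p : ℕ) : Function.Injective (radauNode p) :=
  (Finset.orderEmbOfFin _ _).injective

theorem radauPoly_eval_one (p : ℕ) : (radauPoly p).eval 1 = 0 :=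
  isRoot_iterate_derivative_of_dvd (m := p + 1) (by omega) (by simp)

/-- If a root `r ≠ 1` of the Radau polynomial `(X - 1) (X - r) S` were outside `(0,1)`, then
`(X - 1) (X - r) S ^ 2` would have a constant sign there, but `S` is orthogonal to the Radau
polynomial. -/
theorem mem_Ioc_of_radauPoly_eval_eq_zero {p : ℕ} {r : ℝ} (hr : (radauPoly p).eval r = 0) :
    0 < r ∧ r ≤ 1 := by
  by_cases hr1 : r = 1
  · simp [hr1]
  obtain ⟨S₁, hS₁⟩ := dvd_iff_isRoot.mpr (radauPoly_eval_one p)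
  rw [hS₁, eval_mul] at hr
  have hS₁r : S₁.IsRoot r := by
    rcases mul_eq_zero.mp hr with h | h
    · exact absurd (sub_eq_zero.mp (by simpa using h)) hr1
    · exact h
  obtain ⟨S, hS⟩ := dvd_iff_isRoot.mpr hS₁r
  have hdeg := radauPoly_degree p
  have hne := radauPoly_ne_zero p
  rw [hS₁, hS] at hdeg hne
  have hS0 : S ≠ 0 := by rintro rfl; simp at hne
  rw [degree_mul, degree_mul, degree_X_sub_C, degree_X_sub_C, degree_eq_natDegree hS0] at hdeg
  have horth : unitIntegral ((X - C 1) * ((X - C r) * S) * S) = 0 := by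
    rw [← hS, ← hS₁]
    refine unitIntegral_radauPoly_mul p ?_
    rw [mem_degreeLT, degree_eq_natDegree hS0]
    norm_cast at *
    omega
  by_contra hcon
  rw [not_and_or, not_lt, not_le] at hcon
  rcases hcon with h | h
  · have := unitIntegral_pos (P := -((X - C 1) * ((X - C r) * S) * S))
      (neg_ne_zero.mpr (mul_ne_zero hne hS0)) (fun x hx0 hx1 => by
        simp only [eval_neg, eval_mul, eval_sub, eval_X, eval_C]
        have : 0 ≤ (1 - x) * (x - r) * (S.eval x) ^ 2 :=
          mul_nonneg (mul_nonneg (by linarith) (by linarith)) (sq_nonneg _)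
        linarith)
    rw [map_neg, horth] at this
    simp at this
  · have := unitIntegral_pos (P := (X - C 1) * ((X - C r) * S) * S)
      (mul_ne_zero hne hS0) (fun x hx0 hx1 => by
        simp only [eval_mul, eval_sub, eval_X, eval_C]
        have : 0 ≤ (1 - x) * (r - x) * (S.eval x) ^ 2 :=
          mul_nonneg (mul_nonneg (by linarith) (by linarith)) (sq_nonneg _)
        linarith)
    rw [horth] at this
    simp at this

theorem radauNode_pos (p : ℕ) (i : Fin (p + 1)) : 0 < radauNode p i :=
  (mem_Ioc_of_radauPoly_eval_eq_zero (radauPoly_eval_node p i)).1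

theorem radauNode_le_one (p : ℕ) (i : Fin (p + 1)) : radauNode p i ≤ 1 :=
  (mem_Ioc_of_radauPoly_eval_eq_zero (radauPoly_eval_node p i)).2

theorem radauNode_last (p : ℕ) : radauNode p (Fin.last p) = 1 := by
  refine le_antisymm (radauNode_le_one p _) ?_
  have h1 : (1 : ℝ) ∈ Set.range (radauNode p) := by
    rw [radauNode, Finset.range_orderEmbOfFin, Finset.mem_coe, Multiset.mem_toFinset,
      mem_roots (radauPoly_ne_zero p)]
    exact radauPoly_eval_one p
  obtain ⟨k, hk⟩ := h1
  rw [← hk]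
  exact (Finset.orderEmbOfFin _ _).monotone (Fin.le_last k)

theorem radauLagrange_eval_node (p : ℕ) (i j : Fin (p + 1)) :
    (radauLagrange p j).eval (radauNode p i) = if i = j then 1 else 0 := by
  split_ifs with h
  · subst h
    exact Lagrange.eval_basis_self (radauNode_injective p).injOn (Finset.mem_univ _)
  · exact Lagrange.eval_basis_of_ne (Ne.symm h) (Finset.mem_univ _)

theorem radauLagrange_mem_degreeLT (p : ℕ) (j : Fin (p + 1)) :
    radauLagrange p j ∈ degreeLT ℝ (p + 1) := by
  rw [mem_degreeLT, radauLagrange,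
    Lagrange.degree_basis (radauNode_injective p).injOn (Finset.mem_univ _)]
  simp only [Finset.card_univ, Fintype.card_fin]
  exact_mod_cast Nat.lt_succ_self _

theorem eq_sum_radauLagrange {p : ℕ} {P : ℝ[X]} (hP : P ∈ degreeLT ℝ (p + 1)) :
    P = ∑ j, C (P.eval (radauNode p j)) * radauLagrange p j := by
  rw [mem_degreeLT] at hP
  exact Lagrange.eq_interpolate (s := Finset.univ) (radauNode_injective p).injOn (by simpa using hP)

theorem eq_of_eval_radauNode_eq {p : ℕ} {P Q : ℝ[X]} (hP : P ∈ degreeLT ℝ (p + 1))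
    (hQ : Q ∈ degreeLT ℝ (p + 1))
    (h : ∀ i, P.eval (radauNode p i) = Q.eval (radauNode p i)) : P = Q := by
  rw [eq_sum_radauLagrange hP, eq_sum_radauLagrange hQ]
  simp only [h]

theorem exists_eval_radauNode_eq {p : ℕ} (v : Fin (p + 1) → ℝ) :
    ∃ P ∈ degreeLT ℝ (p + 1), ∀ i, P.eval (radauNode p i) = v i := by
  refine ⟨∑ j, v j • radauLagrange p j, Submodule.sum_mem _ fun j _ =>
    Submodule.smul_mem _ _ (radauLagrange_mem_degreeLT p j), fun i => ?_⟩
  simp [eval_finsetSum, radauLagrange_eval_node]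

theorem radauA_mulVec_eval {p : ℕ} {P : ℝ[X]} (hP : P ∈ degreeLT ℝ (p + 1)) (i : Fin (p + 1)) :
    (radauA p).mulVec (fun k => P.eval (radauNode p k)) i =
      ∫ τ in (0 : ℝ)..radauNode p i, P.eval τ := by
  conv_rhs => rw [eq_sum_radauLagrange hP]
  simp only [eval_finsetSum, eval_mul, eval_C]
  rw [intervalIntegral.integral_finsetSum]
  · simp [Matrix.mulVec, dotProduct, radauA, mul_comm]
  · exact fun j _ => ((radauLagrange p j).continuous.const_mul _).intervalIntegrable _ _

theorem sum_radauB_mul_eval_of_mem_degreeLT {p : ℕ} {P : ℝ[X]} (hP : P ∈ degreeLT ℝ (p + 1)) :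
    ∑ k, radauB p k * P.eval (radauNode p k) = unitIntegral P := by
  conv_rhs => rw [eq_sum_radauLagrange hP]
  rw [map_sum]
  refine Finset.sum_congr rfl fun j _ => ?_
  rw [← smul_eq_C_mul, map_smul, smul_eq_mul, mul_comm]
  rfl

/-- The Radau quadrature formula is exact for polynomials of degree at most `2p`. -/
theorem sum_radauB_mul_eval {p : ℕ} {P : ℝ[X]} (hP : P ∈ degreeLT ℝ (2 * p + 1)) :
    ∑ k, radauB p k * P.eval (radauNode p k) = unitIntegral P := by
  have hne := radauPoly_ne_zero p
  have hdiv : radauPoly p * (P / radauPoly p) + P % radauPoly p = P :=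
    EuclideanDomain.div_add_mod P (radauPoly p)
  have hquot : P / radauPoly p ∈ degreeLT ℝ p := by
    rw [mem_degreeLT] at hP ⊢
    by_cases h : P.degree < (radauPoly p).degree
    · rw [(Polynomial.div_eq_zero_iff hne).mpr h, degree_zero]
      exact WithBot.bot_lt_coe _
    · rw [← degree_add_div hne (not_lt.mp h), radauPoly_degree] at hP
      by_cases h0 : P / radauPoly p = 0
      · rw [h0, degree_zero]; exact WithBot.bot_lt_coe _
      · rw [degree_eq_natDegree h0] at hP ⊢
        norm_cast at *
        omega
  have hrem : P % radauPoly p ∈ degreeLT ℝ (p + 1) := by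
    rw [mem_degreeLT, ← radauPoly_degree]
    exact degree_mod_lt P hne
  conv_rhs => rw [← hdiv, map_add, unitIntegral_radauPoly_mul p hquot, zero_add,
    ← sum_radauB_mul_eval_of_mem_degreeLT hrem]
  refine Finset.sum_congr rfl fun k _ => ?_
  conv_lhs => rw [← hdiv, eval_add, eval_mul, radauPoly_eval_node, zero_mul, zero_add]

theorem radauB_pos (p : ℕ) (j : Fin (p + 1)) : 0 < radauB p j := by
  have hl := radauLagrange_mem_degreeLT p j
  -- The quadrature is exact for `ℓ_j ^ 2`, which is `1` at `ξ_j` and `0` at the other nodes.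
  have h := sum_radauB_mul_eval
    (mul_mem_degreeLT hl hl (by omega : p + 1 + (p + 1) ≤ 2 * p + 1 + 1))
  simp only [eval_mul, radauLagrange_eval_node] at h
  simp only [mul_ite, mul_one, mul_zero, Finset.sum_ite_eq', Finset.mem_univ,
    if_true] at h
  have hne : radauLagrange p j ≠ 0 := by
    intro h0
    have := radauLagrange_eval_node p j j
    simp [h0] at this
  have hpos := unitIntegral_pos (mul_ne_zero hne hne) fun x _ _ => by
    rw [eval_mul]; exact mul_self_nonneg _
  rwa [← h] at hpos

/-! ### The two symbols are similar -/

section Symbols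

variable {p : ℕ} (φ : PolyBasis p)

/-- The polynomial `∑ c_j φ_j` with coefficient vector `c`. -/
noncomputable def polyOfCoeff (c : Fin (p + 1) → ℝ) : ℝ[X] := ∑ j, c j • (φ j : ℝ[X])

/-- The matrix `(φ_j(ξ_k))_{kj}` that takes coefficients to the values at the Radau nodes. -/
noncomputable def nodeMatrix : Matrix (Fin (p + 1)) (Fin (p + 1)) ℝ :=
  Matrix.of fun k j => bval φ j (radauNode p k)

theorem polyOfCoeff_mem (c : Fin (p + 1) → ℝ) : polyOfCoeff φ c ∈ degreeLT ℝ (p + 1) :=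
  Submodule.sum_mem _ fun j _ => Submodule.smul_mem _ _ (φ j).2

theorem eval_polyOfCoeff (c : Fin (p + 1) → ℝ) (x : ℝ) :
    (polyOfCoeff φ c).eval x = ∑ j, bval φ j x * c j := by
  simp [polyOfCoeff, eval_finsetSum, bval, mul_comm]

theorem eq_zero_of_polyOfCoeff_eq_zero {c : Fin (p + 1) → ℝ} (h : polyOfCoeff φ c = 0) :
    c = 0 := by
  have h' : ∑ j, c j • φ j = 0 := by
    apply Subtype.ext
    simpa [polyOfCoeff] using h
  exact funext (Fintype.linearIndependent_iff.mp φ.linearIndependent c h')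

theorem nodeMatrix_mulVec (c : Fin (p + 1) → ℝ) :
    (nodeMatrix φ).mulVec c = fun k => (polyOfCoeff φ c).eval (radauNode p k) := by
  ext k
  rw [eval_polyOfCoeff]
  rfl

theorem isUnit_of_mulVec_eq_zero {n : ℕ} {A : Matrix (Fin n) (Fin n) ℝ}
    (h : ∀ c, A.mulVec c = 0 → c = 0) : IsUnit A := by
  refine Matrix.mulVec_injective_iff_isUnit.mp fun c d hcd => ?_
  refine sub_eq_zero.mp (h _ ?_)
  rw [Matrix.mulVec_sub, hcd, sub_self]

theorem isUnit_nodeMatrix : IsUnit (nodeMatrix φ) := by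
  refine isUnit_of_mulVec_eq_zero fun c hc => eq_zero_of_polyOfCoeff_eq_zero φ ?_
  rw [nodeMatrix_mulVec] at hc
  exact eq_of_eval_radauNode_eq (polyOfCoeff_mem φ c) (Submodule.zero_mem _) fun i => by
    simpa using congrFun hc i

theorem massMatrix_mulVec (c : Fin (p + 1) → ℝ) (i : Fin (p + 1)) :
    (massMatrix φ).mulVec c i = unitIntegral (polyOfCoeff φ c * (φ i : ℝ[X])) := by
  rw [polyOfCoeff, Finset.sum_mul, map_sum]
  change ∑ j, massMatrix φ i j * c j = _
  refine Finset.sum_congr rfl fun j _ => ?_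
  rw [smul_mul_assoc, map_smul, smul_eq_mul, mul_comm]
  simp [massMatrix, bval, unitIntegral]

theorem stiffMatrix_mulVec (c : Fin (p + 1) → ℝ) (i : Fin (p + 1)) :
    (stiffMatrix φ).mulVec c i = unitIntegral (derivative (polyOfCoeff φ c) * (φ i : ℝ[X])) +
      (polyOfCoeff φ c).eval 0 * bval φ i 0 := by
  rw [eval_polyOfCoeff, polyOfCoeff, map_sum, Finset.sum_mul, map_sum, Finset.sum_mul,
    ← Finset.sum_add_distrib]
  change ∑ j, stiffMatrix φ i j * c j = _
  refine Finset.sum_congr rfl fun j _ => ?_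
  rw [derivative_smul, smul_mul_assoc, map_smul, smul_eq_mul]
  simp only [stiffMatrix, bval, unitIntegral, Matrix.of_apply, LinearMap.coe_mk, AddHom.coe_mk,
    eval_mul]
  ring

theorem traceMatrix_mulVec (c : Fin (p + 1) → ℝ) (i : Fin (p + 1)) :
    (traceMatrix φ).mulVec c i = (polyOfCoeff φ c).eval 1 * bval φ i 0 := by
  rw [eval_polyOfCoeff, Finset.sum_mul]
  change ∑ j, traceMatrix φ i j * c j = _
  refine Finset.sum_congr rfl fun j _ => ?_
  simp only [traceMatrix, Matrix.of_apply]
  ring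

theorem isUnit_massMatrix : IsUnit (massMatrix φ) := by
  refine isUnit_of_mulVec_eq_zero fun c hc => eq_zero_of_polyOfCoeff_eq_zero φ ?_
  apply eq_zero_of_unitIntegral_mul_self
  conv_lhs => enter [2, 2]; rw [polyOfCoeff]
  rw [Finset.mul_sum, map_sum]
  refine Finset.sum_eq_zero fun i _ => ?_
  rw [mul_smul_comm, map_smul, ← massMatrix_mulVec, hc]
  simp

/-- The matrix `T⁻¹ A T`, where `T` takes coefficients to node values: in coefficients it is the
map that takes `P` to the interpolant at the Radau nodes of `τ ↦ ∫_0^τ P`. -/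
noncomputable def collocationMatrix : Matrix (Fin (p + 1)) (Fin (p + 1)) ℝ :=
  (nodeMatrix φ)⁻¹ * radauA p * nodeMatrix φ

/-- The matrix `T⁻¹ 𝟙 bᵀ T`: in coefficients it is the map that takes `P` to the constant
`∫_0^1 P`. -/
noncomputable def meanMatrix : Matrix (Fin (p + 1)) (Fin (p + 1)) ℝ :=
  (nodeMatrix φ)⁻¹ * Matrix.of (fun _ j => radauB p j) * nodeMatrix φ

theorem nodeMatrix_mul_inv : nodeMatrix φ * (nodeMatrix φ)⁻¹ = 1 :=
  Matrix.mul_nonsing_inv _ ((Matrix.isUnit_iff_isUnit_det _).mp (isUnit_nodeMatrix φ))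

theorem nodeMatrix_inv_mul : (nodeMatrix φ)⁻¹ * nodeMatrix φ = 1 :=
  Matrix.nonsing_inv_mul _ ((Matrix.isUnit_iff_isUnit_det _).mp (isUnit_nodeMatrix φ))

theorem polyOfCoeff_collocationMatrix_eval_node (c : Fin (p + 1) → ℝ) (k : Fin (p + 1)) :
    (polyOfCoeff φ ((collocationMatrix φ).mulVec c)).eval (radauNode p k) =
      ∫ τ in (0 : ℝ)..radauNode p k, (polyOfCoeff φ c).eval τ := by
  rw [← radauA_mulVec_eval (polyOfCoeff_mem φ c), ← nodeMatrix_mulVec, Matrix.mulVec_mulVec]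
  have h := congrFun (nodeMatrix_mulVec φ ((collocationMatrix φ).mulVec c)) k
  rw [← h, Matrix.mulVec_mulVec, collocationMatrix, Matrix.mul_assoc, ← Matrix.mul_assoc,
    nodeMatrix_mul_inv, Matrix.one_mul]

theorem polyOfCoeff_meanMatrix (c : Fin (p + 1) → ℝ) :
    polyOfCoeff φ ((meanMatrix φ).mulVec c) = C (unitIntegral (polyOfCoeff φ c)) := by
  refine eq_of_eval_radauNode_eq (polyOfCoeff_mem φ _) ?_ fun k => ?_
  · rw [mem_degreeLT]
    exact degree_C_le.trans_lt (by exact_mod_cast Nat.succ_pos p)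
  · have h := congrFun (nodeMatrix_mulVec φ ((meanMatrix φ).mulVec c)) k
    rw [← h, Matrix.mulVec_mulVec, meanMatrix, Matrix.mul_assoc, ← Matrix.mul_assoc,
      nodeMatrix_mul_inv, Matrix.one_mul, ← Matrix.mulVec_mulVec, nodeMatrix_mulVec, eval_C,
      ← sum_radauB_mul_eval_of_mem_degreeLT (polyOfCoeff_mem φ c)]
    rfl

/-- In coefficients, discontinuous Galerkin integration is collocation at the Radau nodes: for the
interpolant `q` of `X a = ∫_0^· P`, the difference `r = X a - q` vanishes at the nodes, so that
`r(1) = 0` and, by exactness of the quadrature, `∫_0^1 r φ_i' = 0`. -/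
theorem stiffMatrix_mul_collocationMatrix :
    stiffMatrix φ * collocationMatrix φ = massMatrix φ := by
  apply Matrix.mulVec_injective
  ext c i
  rw [← Matrix.mulVec_mulVec, stiffMatrix_mulVec, massMatrix_mulVec]
  obtain ⟨a, ha, haP⟩ := exists_derivative_X_mul_eq (polyOfCoeff_mem φ c)
  set q := polyOfCoeff φ ((collocationMatrix φ).mulVec c) with hq
  have hqm : q ∈ degreeLT ℝ (p + 1) := polyOfCoeff_mem φ _
  have hnode : ∀ k, (X * a - q).eval (radauNode p k) = 0 := fun k => by
    rw [eval_sub, hq, polyOfCoeff_collocationMatrix_eval_node, ← haP, integral_eval_derivative]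
    simp
  have h1 : (X * a - q).eval 1 = 0 := by
    have := hnode (Fin.last p)
    rwa [radauNode_last] at this
  have hint : unitIntegral ((X * a - q) * derivative (φ i : ℝ[X])) = 0 := by
    have hd := derivative_mem_degreeLT (φ i).2
    rw [← sum_radauB_mul_eval (p := p)]
    · simp only [eval_mul, hnode, zero_mul, mul_zero, Finset.sum_const_zero]
    · rw [sub_mul]
      refine Submodule.sub_mem _ ?_ ?_
      · refine mul_mem_degreeLT (m := p + 2) (mul_mem_degreeLT X_mem_degreeLT ha ?_) hd ?_ <;> omega
      · exact mul_mem_degreeLT hqm hd (by omega)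
  have hparts := unitIntegral_derivative_mul (X * a - q) (φ i : ℝ[X])
  rw [h1, hint, derivative_sub, sub_mul, map_sub, haP, eval_sub, eval_mul, eval_X] at hparts
  rw [bval]
  linarith

/-- The matrix `(φ_i(0) ∫_0^1 φ_j)_{ij}`. -/
noncomputable def traceMeanMatrix : Matrix (Fin (p + 1)) (Fin (p + 1)) ℝ :=
  Matrix.of fun i j => unitIntegral (φ j : ℝ[X]) * bval φ i 0

theorem traceMeanMatrix_mulVec (c : Fin (p + 1) → ℝ) (i : Fin (p + 1)) :
    (traceMeanMatrix φ).mulVec c i = unitIntegral (polyOfCoeff φ c) * bval φ i 0 := by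
  rw [polyOfCoeff, map_sum, Finset.sum_mul]
  change ∑ j, traceMeanMatrix φ i j * c j = _
  refine Finset.sum_congr rfl fun j _ => ?_
  rw [map_smul, smul_eq_mul, traceMeanMatrix, Matrix.of_apply]
  ring

theorem stiffMatrix_mul_meanMatrix : stiffMatrix φ * meanMatrix φ = traceMeanMatrix φ := by
  apply Matrix.mulVec_injective
  ext c i
  rw [← Matrix.mulVec_mulVec, stiffMatrix_mulVec, traceMeanMatrix_mulVec, polyOfCoeff_meanMatrix]
  simp

theorem traceMatrix_mul_meanMatrix : traceMatrix φ * meanMatrix φ = traceMeanMatrix φ := by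
  apply Matrix.mulVec_injective
  ext c i
  rw [← Matrix.mulVec_mulVec, traceMatrix_mulVec, traceMeanMatrix_mulVec, polyOfCoeff_meanMatrix]
  simp

theorem traceMatrix_mul_collocationMatrix :
    traceMatrix φ * collocationMatrix φ = traceMeanMatrix φ := by
  apply Matrix.mulVec_injective
  ext c i
  rw [← Matrix.mulVec_mulVec, traceMatrix_mulVec, traceMeanMatrix_mulVec]
  have := polyOfCoeff_collocationMatrix_eval_node φ c (Fin.last p)
  rw [radauNode_last] at this
  rw [this]
  rfl

/-- Entrywise inclusion of the real in the complex matrices, as a ring homomorphism. -/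
noncomputable def complexify (n : ℕ) : Matrix (Fin n) (Fin n) ℝ →+* Matrix (Fin n) (Fin n) ℂ :=
  Complex.ofRealHom.mapMatrix

theorem complexify_nodeMatrix_mul_inv :
    complexify _ (nodeMatrix φ) * complexify _ (nodeMatrix φ)⁻¹ = 1 := by
  rw [← map_mul, nodeMatrix_mul_inv, map_one]

theorem complexify_nodeMatrix_inv_mul :
    complexify _ (nodeMatrix φ)⁻¹ * complexify _ (nodeMatrix φ) = 1 := by
  rw [← map_mul, nodeMatrix_inv_mul, map_one]

theorem dgSymbol_eq (z : ℂ) : dgSymbol φ z = (complexify _ (massMatrix φ))⁻¹ *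
    (complexify _ (stiffMatrix φ) - z • complexify _ (traceMatrix φ)) := rfl

/-- Besides `S (T⁻¹ A T) = M`, this uses that `S (T⁻¹ 𝟙 bᵀ T)`, `Z (T⁻¹ A T)` and
`Z (T⁻¹ 𝟙 bᵀ T)`, where `Z` is the trace matrix, are the same matrix `(φ_i(0) ∫_0^1 φ_j)_{ij}`; its
coefficient `w - z - z w` vanishes for `w = z / (1 - z)`. -/
theorem dgSymbol_mul_collocation {z : ℂ} (hz : z ≠ 1) :
    dgSymbol φ z * (complexify _ (collocationMatrix φ) +
      (z / (1 - z)) • complexify _ (meanMatrix φ)) = 1 := by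
  have hM : IsUnit (complexify _ (massMatrix φ)).det :=
    (Matrix.isUnit_iff_isUnit_det _).mp ((isUnit_massMatrix φ).map (complexify _))
  have hz' : 1 - z ≠ 0 := sub_ne_zero.mpr (Ne.symm hz)
  rw [dgSymbol_eq, Matrix.mul_assoc]
  convert Matrix.nonsing_inv_mul _ hM using 2
  rw [Matrix.sub_mul, Matrix.mul_add, Matrix.mul_add, Matrix.mul_smul, Matrix.mul_smul,
    Matrix.smul_mul, Matrix.smul_mul, ← map_mul, ← map_mul, ← map_mul, ← map_mul,
    stiffMatrix_mul_collocationMatrix, stiffMatrix_mul_meanMatrix, traceMatrix_mul_meanMatrix,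
    traceMatrix_mul_collocationMatrix, smul_smul, add_sub_assoc, add_eq_left, ← add_smul,
    ← sub_smul]
  convert zero_smul ℂ _
  field_simp
  ring

/-- The Runge-Kutta symbol is the discontinuous Galerkin symbol, expressed in node values in place
of coefficients. -/
theorem rkSymbol_eq {z : ℂ} (hz : z ≠ 1) : rkSymbol p z =
    complexify _ (nodeMatrix φ) * dgSymbol φ z * complexify _ (nodeMatrix φ)⁻¹ := by
  refine Matrix.inv_eq_left_inv ?_
  have hG : (Matrix.of fun i j => (radauA p i j : ℂ) + z / (1 - z) * (radauB p j : ℂ)) =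
      complexify _ (radauA p) +
        (z / (1 - z)) • complexify _ (Matrix.of fun _ j => radauB p j) := by
    ext i j
    simp [complexify]
  have hT := complexify_nodeMatrix_mul_inv φ
  have h := dgSymbol_mul_collocation φ hz
  rw [collocationMatrix, meanMatrix, map_mul, map_mul, map_mul, map_mul, ← Matrix.smul_mul,
    ← Matrix.mul_smul, ← Matrix.add_mul, ← Matrix.mul_add, ← hG] at h
  set T := complexify _ (nodeMatrix φ)
  set T' := complexify _ (nodeMatrix φ)⁻¹
  set G := (Matrix.of fun i j => (radauA p i j : ℂ) + z / (1 - z) * (radauB p j : ℂ))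
  calc T * dgSymbol φ z * T' * G = T * (dgSymbol φ z * (T' * G * T)) * T' := by
        simp only [Matrix.mul_assoc, hT, Matrix.mul_one]
    _ = 1 := by rw [h, Matrix.mul_one, hT]

/-! ### The spectrum of the symbols at the origin -/

/-- Collocation at the Radau nodes is coercive in the inner product with weights `b_k / ξ_k`: if
`x` are the values of `P` and `X a = ∫_0^· P`, then the quadrature of `P a` is exact, and equal to
`(∫_0^1 a² + a(1)²) / 2`. -/
theorem radauA_coercive (x : Fin (p + 1) → ℝ) :
    1 / 2 * ∑ k, radauB p k / radauNode p k * (radauA p).mulVec x k ^ 2 ≤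
      ∑ k, radauB p k / radauNode p k * (x k * (radauA p).mulVec x k) := by
  obtain ⟨P, hP, hPx⟩ := exists_eval_radauNode_eq x
  obtain ⟨a, ha, haP⟩ := exists_derivative_X_mul_eq hP
  have hA : ∀ k, (radauA p).mulVec x k = radauNode p k * a.eval (radauNode p k) := fun k => by
    rw [← funext hPx, radauA_mulVec_eval hP, ← haP, integral_eval_derivative]
    simp
  have hexact := sum_radauB_mul_eval
    (mul_mem_degreeLT hP ha (by omega : p + 1 + (p + 1) ≤ 2 * p + 1 + 1))
  have hexact' := sum_radauB_mul_eval
    (mul_mem_degreeLT ha ha (by omega : p + 1 + (p + 1) ≤ 2 * p + 1 + 1))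
  have hhalf := unitIntegral_derivative_X_mul_mul_self a
  rw [haP, ← hexact, ← hexact'] at hhalf
  simp only [eval_mul, hPx] at hhalf
  have h1 : ∑ k, radauB p k / radauNode p k * (x k * (radauA p).mulVec x k) =
      ∑ k, radauB p k * (x k * a.eval (radauNode p k)) := by
    refine Finset.sum_congr rfl fun k _ => ?_
    have := (radauNode_pos p k).ne'
    rw [hA]; field_simp
  have h2 : ∑ k, radauB p k / radauNode p k * (radauA p).mulVec x k ^ 2 ≤
      ∑ k, radauB p k * (a.eval (radauNode p k) * a.eval (radauNode p k)) := by
    refine Finset.sum_le_sum fun k _ => ?_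
    have := (radauNode_pos p k).ne'
    rw [hA]
    calc radauB p k / radauNode p k * (radauNode p k * a.eval (radauNode p k)) ^ 2 =
        radauNode p k * (radauB p k * (a.eval (radauNode p k) * a.eval (radauNode p k))) := by
          field_simp
      _ ≤ 1 * (radauB p k * (a.eval (radauNode p k) * a.eval (radauNode p k))) :=
          mul_le_mul_of_nonneg_right (radauNode_le_one p k)
            (mul_nonneg (radauB_pos p k).le (mul_self_nonneg _))
      _ = _ := one_mul _
  rw [h1, hhalf]
  nlinarith [mul_self_nonneg (a.eval 1)]

/-- If `w = l A w` for a complex vector `w ≠ 0`, then `1/2 ≤ Re l`. -/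
theorem half_le_re_of_eq_smul_radauA {w : Fin (p + 1) → ℂ} (hw : w ≠ 0) {l : ℂ}
    (h : w = l • (complexify _ (radauA p)).mulVec w) : 1 / 2 ≤ l.re := by
  set x : Fin (p + 1) → ℝ := fun k => (w k).re
  set y : Fin (p + 1) → ℝ := fun k => (w k).im
  have hre : ∀ k, ((complexify _ (radauA p)).mulVec w k).re = (radauA p).mulVec x k := fun k => by
    simp [Matrix.mulVec, dotProduct, complexify, x]
  have him : ∀ k, ((complexify _ (radauA p)).mulVec w k).im = (radauA p).mulVec y k := fun k => by
    simp [Matrix.mulVec, dotProduct, complexify, y]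
  set s := (radauA p).mulVec x with hs
  set t := (radauA p).mulVec y with ht
  have hx : ∀ k, x k = l.re * s k - l.im * t k := fun k => by
    have := congrArg Complex.re (congrFun h k)
    rw [Pi.smul_apply, smul_eq_mul, Complex.mul_re, hre, him] at this
    exact this
  have hy : ∀ k, y k = l.re * t k + l.im * s k := fun k => by
    have := congrArg Complex.im (congrFun h k)
    rw [Pi.smul_apply, smul_eq_mul, Complex.mul_im, hre, him] at this
    exact this
  have hc : ∀ k, 0 < radauB p k / radauNode p k := fun k =>
    div_pos (radauB_pos p k) (radauNode_pos p k)
  have hsum := add_le_add (radauA_coercive x) (radauA_coercive y)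
  rw [← hs, ← ht, ← mul_add, ← Finset.sum_add_distrib, ← Finset.sum_add_distrib] at hsum
  have heq : ∑ k, (radauB p k / radauNode p k * (x k * s k) +
      radauB p k / radauNode p k * (y k * t k)) =
      l.re * ∑ k, (radauB p k / radauNode p k * s k ^ 2 +
        radauB p k / radauNode p k * t k ^ 2) := by
    rw [Finset.mul_sum]
    refine Finset.sum_congr rfl fun k _ => ?_
    rw [hx, hy]; ring
  rw [heq] at hsum
  refine le_of_mul_le_mul_right hsum ?_
  have hnonneg : ∀ k, 0 ≤ radauB p k / radauNode p k * s k ^ 2 +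
      radauB p k / radauNode p k * t k ^ 2 := fun k =>
    add_nonneg (mul_nonneg (hc k).le (sq_nonneg _)) (mul_nonneg (hc k).le (sq_nonneg _))
  refine lt_of_le_of_ne (Finset.sum_nonneg fun k _ => hnonneg k) fun h0 => hw ?_
  have hz := (Finset.sum_eq_zero_iff_of_nonneg fun k _ => hnonneg k).mp h0.symm
  ext k
  have hk := hz k (Finset.mem_univ k)
  have hsk : s k ^ 2 + t k ^ 2 = 0 := by
    rw [← mul_add] at hk
    exact (mul_eq_zero.mp hk).resolve_left (hc k).ne'
  have hs0 : s k = 0 := by nlinarith [sq_nonneg (s k), sq_nonneg (t k)]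
  have ht0 : t k = 0 := by nlinarith [sq_nonneg (s k), sq_nonneg (t k)]
  apply Complex.ext
  · simpa [hs0, ht0] using hx k
  · simpa [hs0, ht0] using hy k

/-- The node values `w = T v` of an eigenvector `v` of `δ(0) = T⁻¹ A⁻¹ T` satisfy `w = l A w`. -/
theorem half_le_re_of_mem_spectrum_dgSymbol_zero {l : ℂ} (hl : l ∈ spectrum ℂ (dgSymbol φ 0)) :
    1 / 2 ≤ l.re := by
  rw [← Matrix.spectrum_toLin', ← Module.End.hasEigenvalue_iff_mem_spectrum] at hl
  obtain ⟨v, hv⟩ := hl.exists_hasEigenvector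
  have hv1 : (dgSymbol φ 0).mulVec v = l • v := by simpa using hv.apply_eq_smul
  have h1 := dgSymbol_mul_collocation φ (zero_ne_one (α := ℂ))
  rw [zero_div, zero_smul, add_zero] at h1
  have hv2 : v = l • (complexify _ (collocationMatrix φ)).mulVec v := by
    rw [← Matrix.mulVec_smul, ← hv1, Matrix.mulVec_mulVec, mul_eq_one_comm.mp h1,
      Matrix.one_mulVec]
  have hT := complexify_nodeMatrix_mul_inv φ
  refine half_le_re_of_eq_smul_radauA (w := (complexify _ (nodeMatrix φ)).mulVec v) ?_ ?_
  · intro h0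
    refine hv.2 ?_
    rw [← Matrix.one_mulVec v, ← complexify_nodeMatrix_inv_mul φ, ← Matrix.mulVec_mulVec, h0,
      Matrix.mulVec_zero]
  · conv_lhs => rw [hv2]
    rw [Matrix.mulVec_smul, Matrix.mulVec_mulVec, Matrix.mulVec_mulVec, collocationMatrix, map_mul,
      map_mul, ← Matrix.mul_assoc, ← Matrix.mul_assoc, hT, Matrix.one_mul]

end Symbols

/-! ### Contour integrals do not depend on the circle -/

section Contour

/-- The rational function `∏_{w ∈ s} (l - w)⁻¹` with the multiset `s` of poles. -/
noncomputable def invProd (s : Multiset ℂ) (l : ℂ) : ℂ := (s.map fun w => (l - w)⁻¹).prod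

theorem invProd_zero (l : ℂ) : invProd 0 l = 1 := by
  simp [invProd]

theorem invProd_cons (w : ℂ) (s : Multiset ℂ) (l : ℂ) :
    invProd (w ::ₘ s) l = (l - w)⁻¹ * invProd s l := by
  simp [invProd]

theorem continuousOn_invProd {s : Multiset ℂ} {t : Set ℂ} (h : ∀ w ∈ s, w ∉ t) :
    ContinuousOn (invProd s) t := by
  induction s using Multiset.induction_on with
  | empty =>
    simp only [funext invProd_zero]
    exact continuousOn_const
  | cons w s ih =>
    simp only [Multiset.mem_cons, forall_eq_or_imp, funext (invProd_cons w s)] at h ⊢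
    refine ContinuousOn.mul (ContinuousOn.inv₀ (by fun_prop) fun l hl h0 => h.1 ?_) (ih h.2)
    rwa [← sub_eq_zero.mp h0]

theorem notMem_sphere_of_mem_ball {w c : ℂ} {r : ℝ} (h : w ∈ Metric.ball c r) :
    w ∉ Metric.sphere c r := fun h' => (Metric.mem_ball.mp h).ne (Metric.mem_sphere.mp h')

/-- The contour integral of `∏ (l - w)⁻¹` is the same over all circles that encircle the poles.
Partial fractions reduce the claim to a single, possibly multiple, pole. -/
theorem circleIntegral_invProd_eq {c c' : ℂ} {r r' : ℝ} (hr : 0 < r) (hr' : 0 < r')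
    (s : Multiset ℂ) (hs : ∀ w ∈ s, w ∈ Metric.ball c r) (hs' : ∀ w ∈ s, w ∈ Metric.ball c' r') :
    ∮ l in C(c, r), invProd s l = ∮ l in C(c', r'), invProd s l := by
  induction hn : s.card using Nat.strong_induction_on generalizing s with
  | _ n ih =>
  -- Either there are two distinct poles, and the number of poles can be reduced, or the integrand
  -- is `(l - w) ^ (-n)`.
  by_cases hdist : ∃ w w' t, w ≠ w' ∧ s = w ::ₘ w' ::ₘ t
  · obtain ⟨w, w', t, hne, rfl⟩ := hdist
    have hne' : w - w' ≠ 0 := sub_ne_zero.mpr hne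
    have hsplit : ∀ {c : ℂ} {r : ℝ}, 0 < r → (∀ x ∈ w ::ₘ w' ::ₘ t, x ∈ Metric.ball c r) →
        ∮ l in C(c, r), invProd (w ::ₘ w' ::ₘ t) l =
          (w - w')⁻¹ * ((∮ l in C(c, r), invProd (w ::ₘ t) l) -
            ∮ l in C(c, r), invProd (w' ::ₘ t) l) := by
      intro c r hr hs
      have hint : ∀ u ∈ w ::ₘ w' ::ₘ t, CircleIntegrable (invProd (u ::ₘ t)) c r := fun u hu =>
        (continuousOn_invProd fun x hx => notMem_sphere_of_mem_ball (by
          rcases Multiset.mem_cons.mp hx with rfl | hx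
          · exact hs _ hu
          · exact hs _ (by simp [hx]))).circleIntegrable hr.le
      rw [← circleIntegral.integral_sub (hint w (by simp)) (hint w' (by simp)),
        ← circleIntegral.integral_const_mul]
      refine circleIntegral.integral_congr hr.le fun l hl => ?_
      have h1 : l - w ≠ 0 := fun h0 => notMem_sphere_of_mem_ball (hs w (by simp))
        (sub_eq_zero.mp h0 ▸ hl)
      have h2 : l - w' ≠ 0 := fun h0 => notMem_sphere_of_mem_ball (hs w' (by simp))
        (sub_eq_zero.mp h0 ▸ hl)
      simp only [invProd_cons]
      field_simp
      ring
    have hcard : ∀ u, (u ::ₘ t).card < n := fun u => by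
      rw [← hn]; simp
    rw [hsplit hr hs, hsplit hr' hs']
    simp only [Multiset.mem_cons, forall_eq_or_imp] at hs hs'
    rw [ih _ (hcard w) _ (by simpa using ⟨hs.1, hs.2.2⟩) (by simpa using ⟨hs'.1, hs'.2.2⟩) rfl,
      ih _ (hcard w') _ (by simpa using hs.2) (by simpa using hs'.2) rfl]
  · rcases s.empty_or_exists_mem with rfl | ⟨w, hw⟩
    · have hconst : ∀ {c : ℂ} {r : ℝ}, 0 < r → ∮ l in C(c, r), invProd 0 l = 0 := fun hr => by
        refine DiffContOnCl.circleIntegral_eq_zero hr.le ?_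
        simp only [funext invProd_zero]
        exact diffContOnCl_const
      rw [hconst hr, hconst hr']
    · have hall : ∀ x ∈ s, x = w := by
        intro x hx
        by_contra hxw
        obtain ⟨t, rfl⟩ := Multiset.exists_cons_of_mem hw
        obtain ⟨t', rfl⟩ := Multiset.exists_cons_of_mem
          ((Multiset.mem_cons.mp hx).resolve_left hxw)
        exact hdist ⟨w, x, t', Ne.symm hxw, rfl⟩
      have hfun : invProd s = fun l => (l - w) ^ (-(n : ℤ)) := by
        funext l
        rw [Multiset.eq_replicate_of_mem hall, hn]
        simp [invProd]
      rw [hfun]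
      by_cases h1 : n = 1
      · subst h1
        simp only [Nat.cast_one, zpow_neg_one]
        rw [circleIntegral.integral_sub_inv_of_mem_ball (hs w hw),
          circleIntegral.integral_sub_inv_of_mem_ball (hs' w hw)]
      · rw [circleIntegral.integral_sub_zpow_of_ne (by omega),
          circleIntegral.integral_sub_zpow_of_ne (by omega)]

variable {V : Type*} [NormedAddCommGroup V] [NormedSpace ℂ V] [CompleteSpace V]

/-- The contour integral of `∏ (l - w)⁻¹ f(l)`, `f` holomorphic on the open set `U`, is the same
over all circles that lie with their interior in `U` and encircle the poles. One pole `w` at a time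
is removed by writing `f(l) = f(w) + (l - w) g(l)`. -/
theorem circleIntegral_invProd_smul_eq {c c' : ℂ} {r r' : ℝ} (hr : 0 < r) (hr' : 0 < r')
    {U : Set ℂ} (hU : IsOpen U) (hc : Metric.closedBall c r ⊆ U) (hc' : Metric.closedBall c' r' ⊆ U)
    (s : Multiset ℂ) (hs : ∀ w ∈ s, w ∈ Metric.ball c r) (hs' : ∀ w ∈ s, w ∈ Metric.ball c' r')
    {f : ℂ → V} (hf : DifferentiableOn ℂ f U) :
    ∮ l in C(c, r), invProd s l • f l = ∮ l in C(c', r'), invProd s l • f l := by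
  induction s using Multiset.induction_on generalizing f with
  | empty =>
    have hzero : ∀ {c : ℂ} {r : ℝ}, 0 < r → Metric.closedBall c r ⊆ U →
        ∮ l in C(c, r), invProd 0 l • f l = 0 := fun hr hc => by
      refine DiffContOnCl.circleIntegral_eq_zero hr.le ?_
      simp only [invProd_zero, one_smul]
      exact (hf.mono hc).diffContOnCl_ball subset_rfl
    rw [hzero hr hc, hzero hr' hc']
  | cons w s ih =>
    have hwU : U ∈ 𝓝 w := hU.mem_nhds (hc (Metric.ball_subset_closedBall (hs w (by simp))))
    have hg : DifferentiableOn ℂ (dslope f w) U := (Complex.differentiableOn_dslope hwU).mpr hf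
    have hsplit : ∀ {c : ℂ} {r : ℝ}, 0 < r → Metric.closedBall c r ⊆ U →
        (∀ x ∈ w ::ₘ s, x ∈ Metric.ball c r) →
        ∮ l in C(c, r), invProd (w ::ₘ s) l • f l =
          (∮ l in C(c, r), invProd (w ::ₘ s) l) • f w +
            ∮ l in C(c, r), invProd s l • dslope f w l := by
      intro c r hr hc hs
      have h1 : ContinuousOn (invProd (w ::ₘ s)) (Metric.sphere c r) :=
        continuousOn_invProd fun x hx => notMem_sphere_of_mem_ball (hs x hx)
      have h2 : ContinuousOn (invProd s) (Metric.sphere c r) :=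
        continuousOn_invProd fun x hx => notMem_sphere_of_mem_ball (hs x (by simp [hx]))
      rw [← circleIntegral.integral_smul_const, ← circleIntegral.integral_add]
      · refine circleIntegral.integral_congr hr.le fun l hl => ?_
        have hlw : l ≠ w := fun h0 => notMem_sphere_of_mem_ball (hs w (by simp)) (h0 ▸ hl)
        rw [dslope_of_ne _ hlw, slope, invProd_cons, vsub_eq_sub, smul_smul,
          mul_comm (invProd s l) (l - w)⁻¹, ← smul_add, add_sub_cancel]
      · exact (h1.smul continuousOn_const).circleIntegrable hr.le
      · exact (h2.smul (hg.continuousOn.mono (Metric.sphere_subset_closedBall.trans hc))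
          ).circleIntegrable hr.le
    rw [hsplit hr hc hs, hsplit hr' hc' hs', circleIntegral_invProd_eq hr hr' _ hs hs',
      ih (fun x hx => hs x (by simp [hx])) (fun x hx => hs' x (by simp [hx])) hg]

end Contour

/-! ### Functional calculus of matrices -/

section Calculus

variable {E F : Type*} [NormedAddCommGroup E] [NormedSpace ℂ E]
  [NormedAddCommGroup F] [NormedSpace ℂ F] {m : ℕ}

variable (E F) in
/-- The operator matrix with the single entry `T` at `(i, j)`, as a continuous linear function
of `T`. -/
noncomputable def entryMap (i j : Fin m) : (E →L[ℂ] F) →L[ℂ] ((Fin m → E) →L[ℂ] (Fin m → F)) :=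
  (ContinuousLinearMap.compL ℂ (Fin m → E) F (Fin m → F)
      (ContinuousLinearMap.single ℂ (fun _ : Fin m => F) i)).comp
    ((ContinuousLinearMap.compL ℂ (Fin m → E) E F).flip (ContinuousLinearMap.proj j))

theorem kron_apply (A : Matrix (Fin m) (Fin m) ℂ) (T : E →L[ℂ] F) (v : Fin m → E) (i : Fin m) :
    kron A T v i = ∑ j, A i j • T (v j) := by
  simp [kron]

theorem kron_eq_sum (A : Matrix (Fin m) (Fin m) ℂ) (T : E →L[ℂ] F) :
    kron A T = ∑ i, ∑ j, A i j • entryMap E F i j T := by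
  ext v k
  simp [kron_apply, entryMap, Pi.single_apply]

theorem kron_mul_comp {G : Type*} [NormedAddCommGroup G] [NormedSpace ℂ G]
    (A B : Matrix (Fin m) (Fin m) ℂ) (T : F →L[ℂ] G) (S : E →L[ℂ] F) :
    kron (A * B) (T.comp S) = (kron A T).comp (kron B S) := by
  ext v i
  simp only [kron_apply, ContinuousLinearMap.comp_apply, map_sum, map_smul, Finset.smul_sum,
    smul_smul, Matrix.mul_apply, Finset.sum_smul]
  exact Finset.sum_comm

theorem kron_one_id : kron (1 : Matrix (Fin m) (Fin m) ℂ) (ContinuousLinearMap.id ℂ E) =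
    ContinuousLinearMap.id ℂ (Fin m → E) := by
  ext v i
  simp [kron_apply, Matrix.one_apply]

theorem isOpen_halfPlane (σ : ℝ) : IsOpen (halfPlane σ) :=
  isOpen_lt continuous_const Complex.continuous_re

/-- The entries of the resolvent are polynomials divided by the characteristic polynomial. -/
theorem resolvent_apply (B : Matrix (Fin m) (Fin m) ℂ) (l : ℂ) (i j : Fin m) :
    ((l • (1 : Matrix (Fin m) (Fin m) ℂ) - B)⁻¹) i j =
      invProd B.charpoly.roots l * (B.charmatrix.adjugate i j).eval l := by
  have hscalar : Matrix.scalar (Fin m) l - B = l • (1 : Matrix (Fin m) (Fin m) ℂ) - B := by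
    rw [Matrix.smul_one_eq_diagonal]; rfl
  have hdet : (l • (1 : Matrix (Fin m) (Fin m) ℂ) - B).det =
      (B.charpoly.roots.map fun w => l - w).prod := by
    rw [← hscalar, ← Matrix.eval_charpoly]
    conv_lhs => rw [(IsAlgClosed.splits B.charpoly).eq_prod_roots_of_monic B.charpoly_monic]
    rw [eval_multiset_prod, Multiset.map_map]
    simp
  have hadj : (l • (1 : Matrix (Fin m) (Fin m) ℂ) - B).adjugate i j =
      (B.charmatrix.adjugate i j).eval l := by
    have hev : l • (1 : Matrix (Fin m) (Fin m) ℂ) - B =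
        (evalRingHom l).mapMatrix B.charmatrix := by
      rw [← hscalar]
      ext a b
      by_cases hab : a = b
      · subst hab; simp
      · simp [hab]
    rw [hev, ← RingHom.map_adjugate]
    rfl
  rw [Matrix.inv_def, Matrix.smul_apply, smul_eq_mul, hdet, hadj, Ring.inverse_eq_inv', invProd,
    Multiset.prod_map_inv]

theorem mem_roots_charpoly_iff {B : Matrix (Fin m) (Fin m) ℂ} {w : ℂ} :
    w ∈ B.charpoly.roots ↔ w ∈ spectrum ℂ B := by
  rw [mem_roots B.charpoly_monic.ne_zero, Matrix.mem_spectrum_iff_isRoot_charpoly]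

variable {σ : ℝ} {K : ℂ → E →L[ℂ] F} {B : Matrix (Fin m) (Fin m) ℂ}

theorem circleIntegrable_entry (hK : DifferentiableOn ℂ K (halfPlane σ)) {c : ℂ × ℝ}
    (hc : Encircles σ B c) (i j : Fin m) : CircleIntegrable
      (fun l => ((l • (1 : Matrix (Fin m) (Fin m) ℂ) - B)⁻¹) i j • entryMap E F i j (K l))
      c.1 c.2 := by
  refine ContinuousOn.circleIntegrable hc.1.le ?_
  simp only [resolvent_apply]
  refine ContinuousOn.smul (ContinuousOn.mul (continuousOn_invProd fun w hw =>
    notMem_sphere_of_mem_ball (hc.2.2 (mem_roots_charpoly_iff.mp hw)))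
    (Polynomial.continuous _).continuousOn) ?_
  exact (entryMap E F i j).continuous.comp_continuousOn
    (hK.continuousOn.mono (Metric.sphere_subset_closedBall.trans hc.2.1))

theorem circleIntegrable_kron (hK : DifferentiableOn ℂ K (halfPlane σ)) {c : ℂ × ℝ}
    (hc : Encircles σ B c) : CircleIntegrable
      (fun l => kron ((l • (1 : Matrix (Fin m) (Fin m) ℂ) - B)⁻¹) (K l)) c.1 c.2 := by
  simp only [kron_eq_sum]
  exact CircleIntegrable.fun_sum _ fun i _ => CircleIntegrable.fun_sum _ fun j _ =>
    circleIntegrable_entry hK hc i j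

theorem encircles_spectralCircle (hB : spectrum ℂ B ⊆ halfPlane σ) :
    Encircles σ B (spectralCircle σ B) :=
  Classical.epsilon_spec (exists_encircles σ B hB)

/-- The functional calculus may be computed along any circle that encircles the spectrum. -/
theorem matFun_eq_of_encircles [CompleteSpace F] (hK : DifferentiableOn ℂ K (halfPlane σ))
    {c : ℂ × ℝ} (hc : Encircles σ B c) :
    matFun σ K B = (2 * (Real.pi : ℂ) * Complex.I)⁻¹ •
      ∮ l in C(c.1, c.2), kron ((l • (1 : Matrix (Fin m) (Fin m) ℂ) - B)⁻¹) (K l) := by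
  have hc' : Encircles σ B (spectralCircle σ B) :=
    encircles_spectralCircle fun w hw => hc.2.1 (Metric.ball_subset_closedBall (hc.2.2 hw))
  rw [matFun]
  congr 1
  simp only [kron_eq_sum]
  have hI := fun i j => circleIntegrable_entry hK hc i j
  have hI' := fun i j => circleIntegrable_entry hK hc' i j
  rw [circleIntegral.integral_fun_sum fun i _ => CircleIntegrable.fun_sum _ fun j _ => hI i j,
    circleIntegral.integral_fun_sum fun i _ => CircleIntegrable.fun_sum _ fun j _ => hI' i j]
  refine Finset.sum_congr rfl fun i _ => ?_
  rw [circleIntegral.integral_fun_sum fun j _ => hI i j,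
    circleIntegral.integral_fun_sum fun j _ => hI' i j]
  refine Finset.sum_congr rfl fun j _ => ?_
  simp only [resolvent_apply, mul_smul]
  exact circleIntegral_invProd_smul_eq hc'.1 hc.1 (isOpen_halfPlane σ) hc'.2.1 hc.2.1 _
    (fun w hw => hc'.2.2 (mem_roots_charpoly_iff.mp hw))
    (fun w hw => hc.2.2 (mem_roots_charpoly_iff.mp hw))
    ((Polynomial.differentiable _).differentiableOn.smul
      ((entryMap E F i j).differentiable.comp_differentiableOn hK))

theorem circleIntegral_clm_comp {V W : Type*} [NormedAddCommGroup V] [NormedSpace ℂ V]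
    [CompleteSpace V] [NormedAddCommGroup W] [NormedSpace ℂ W] [CompleteSpace W] (L : V →L[ℂ] W)
    {f : ℂ → V} {c : ℂ} {r : ℝ} (hf : CircleIntegrable f c r) :
    ∮ l in C(c, r), L (f l) = L (∮ l in C(c, r), f l) := by
  rw [circleIntegral, circleIntegral, ← L.intervalIntegral_comp_comm hf.out]
  simp only [map_smul]

theorem spectrum_conj {P Q : Matrix (Fin m) (Fin m) ℂ} (hPQ : P * Q = 1) :
    spectrum ℂ (P * B * Q) = spectrum ℂ B :=
  spectrum.units_conjugate (u := ⟨P, Q, hPQ, mul_eq_one_comm.mp hPQ⟩)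

variable (E F) in
/-- The conjugation `M ↦ (P ⊗ I) M (Q ⊗ I)` of operator matrices. -/
noncomputable def conjCLM (P Q : Matrix (Fin m) (Fin m) ℂ) :
    ((Fin m → E) →L[ℂ] (Fin m → F)) →L[ℂ] ((Fin m → E) →L[ℂ] (Fin m → F)) :=
  (ContinuousLinearMap.compL ℂ (Fin m → E) (Fin m → F) (Fin m → F)
      (kron P (ContinuousLinearMap.id ℂ F))).comp
    ((ContinuousLinearMap.compL ℂ (Fin m → E) (Fin m → E) (Fin m → F)).flip
      (kron Q (ContinuousLinearMap.id ℂ E)))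

theorem conjCLM_apply (P Q : Matrix (Fin m) (Fin m) ℂ) (M : (Fin m → E) →L[ℂ] (Fin m → F)) :
    conjCLM E F P Q M = (kron P (ContinuousLinearMap.id ℂ F)).comp
      (M.comp (kron Q (ContinuousLinearMap.id ℂ E))) := rfl

/-- The functional calculus commutes with similarity. Similar matrices have the same spectrum, hence
the same circle is chosen for them. -/
theorem matFun_conj [CompleteSpace F] (hK : DifferentiableOn ℂ K (halfPlane σ))
    {P Q : Matrix (Fin m) (Fin m) ℂ} (hPQ : P * Q = 1) (hB : spectrum ℂ B ⊆ halfPlane σ) :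
    matFun σ K (P * B * Q) = conjCLM E F P Q (matFun σ K B) := by
  have hcircle : spectralCircle σ (P * B * Q) = spectralCircle σ B := by
    unfold spectralCircle Encircles
    rw [spectrum_conj hPQ]
  rw [matFun, matFun, hcircle, map_smul,
    ← circleIntegral_clm_comp _ (circleIntegrable_kron hK (encircles_spectralCircle hB))]
  congr 2
  funext l
  have hinv : (l • (1 : Matrix (Fin m) (Fin m) ℂ) - P * B * Q)⁻¹ =
      P * ((l • (1 : Matrix (Fin m) (Fin m) ℂ) - B)⁻¹ * Q) := by
    have h1 : l • (1 : Matrix (Fin m) (Fin m) ℂ) - P * B * Q =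
        P * (l • (1 : Matrix (Fin m) (Fin m) ℂ) - B) * Q := by
      rw [Matrix.mul_sub, Matrix.sub_mul, Matrix.mul_smul, Matrix.smul_mul, Matrix.mul_one, hPQ]
    rw [h1, Matrix.mul_inv_rev, Matrix.mul_inv_rev, Matrix.inv_eq_left_inv hPQ,
      Matrix.inv_eq_right_inv hPQ]
  rw [hinv, conjCLM_apply, ← kron_mul_comp, ← kron_mul_comp, ContinuousLinearMap.comp_id,
    ContinuousLinearMap.id_comp]

end Calculus

/-! ### Convolution quadrature weights -/

/-- A contour integral is holomorphic in a parameter, if the integrand is continuously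
differentiable in the parameter and the integration variable. -/
theorem differentiableAt_circleIntegral {V : Type*} [NormedAddCommGroup V] [NormedSpace ℂ V]
    {f : ℂ × ℂ → V} {W : Set (ℂ × ℂ)} (hW : IsOpen W) (hf : ContDiffOn ℂ 1 f W)
    {z₀ c : ℂ} {r : ℝ} (hr : 0 ≤ r) (hz₀ : ∀ l ∈ Metric.sphere c r, (z₀, l) ∈ W) :
    DifferentiableAt ℂ (fun z => ∮ l in C(c, r), f (z, l)) z₀ := by
  obtain ⟨u, v, hu, -, hzu, hv, huv⟩ := generalized_tube_lemma (isCompact_singleton (x := z₀))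
    (isCompact_sphere c r) hW (by rintro ⟨z, l⟩ ⟨rfl, hl⟩; exact hz₀ l hl)
  obtain ⟨ε, hε, hεu⟩ := Metric.nhds_basis_closedBall.mem_iff.mp
    (hu.mem_nhds (hzu (Set.mem_singleton z₀)))
  have hsub : Metric.closedBall z₀ ε ×ˢ Metric.sphere c r ⊆ W :=
    (Set.prod_mono hεu hv).trans huv
  have hmem : ∀ z ∈ Metric.ball z₀ ε, ∀ θ, (z, circleMap c r θ) ∈ W := fun z hz θ =>
    hsub ⟨Metric.ball_subset_closedBall hz, circleMap_mem_sphere c hr θ⟩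
  have hfd : ContinuousOn (fun q : ℂ × ℂ => fderiv ℂ f q (1, 0)) W :=
    (hf.continuousOn_fderiv_of_isOpen hW le_rfl).clm_apply continuousOn_const
  obtain ⟨M, hM⟩ := ((isCompact_closedBall z₀ ε).prod (isCompact_sphere c r)
    ).exists_bound_of_continuousOn (hfd.mono hsub)
  have hpath : ∀ z ∈ Metric.ball z₀ ε, ∀ {g : ℂ × ℂ → V}, ContinuousOn g W →
      Continuous fun θ : ℝ => deriv (circleMap c r) θ • g (z, circleMap c r θ) := by
    intro z hz g hg
    refine Continuous.smul ?_ ?_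
    · rw [funext (deriv_circleMap c r)]
      exact (continuous_circleMap 0 r).mul continuous_const
    · exact hg.comp_continuous (by fun_prop) (hmem z hz)
  have hball : Metric.ball z₀ ε ∈ 𝓝 z₀ := Metric.ball_mem_nhds z₀ hε
  have hz₀b : z₀ ∈ Metric.ball z₀ ε := Metric.mem_ball_self hε
  refine (intervalIntegral.hasDerivAt_integral_of_dominated_loc_of_deriv_le
    (F := fun z θ => deriv (circleMap c r) θ • f (z, circleMap c r θ))
    (F' := fun z θ => deriv (circleMap c r) θ • fderiv ℂ f (z, circleMap c r θ) (1, 0))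
    (bound := fun _ => |r| * M) hball ?_ ?_ ?_ ?_ ?_ ?_).2.differentiableAt
  · filter_upwards [hball] with z hz
    exact (hpath z hz hf.continuousOn).aestronglyMeasurable
  · exact (hpath z₀ hz₀b hf.continuousOn).intervalIntegrable _ _
  · exact (hpath z₀ hz₀b hfd).aestronglyMeasurable
  · refine Eventually.of_forall fun θ _ z hz => ?_
    rw [norm_smul]
    refine mul_le_mul (by simp) (hM _ ⟨Metric.ball_subset_closedBall hz,
      circleMap_mem_sphere c hr θ⟩) (norm_nonneg _) (abs_nonneg r)
  · exact intervalIntegrable_const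
  · refine Eventually.of_forall fun θ _ z hz => ?_
    have h1 : HasFDerivAt f (fderiv ℂ f (z, circleMap c r θ)) (z, circleMap c r θ) :=
      ((hf.contDiffAt (hW.mem_nhds (hmem z hz θ))).differentiableAt one_ne_zero).hasFDerivAt
    have h2 : HasDerivAt (fun z : ℂ => (z, circleMap c r θ)) (1, 0) z :=
      (hasDerivAt_id z).prodMk (hasDerivAt_const z _)
    exact (h1.comp_hasDerivAt z h2).const_smul _

section Weights

attribute [local instance] Matrix.linftyOpNormedRing Matrix.linftyOpNormedAlgebra

variable {E F : Type*} [NormedAddCommGroup E] [NormedSpace ℂ E]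
  [NormedAddCommGroup F] [NormedSpace ℂ F] {m : ℕ} {σ : ℝ} {K : ℂ → E →L[ℂ] F}

/-- The functional calculus of a pencil `B₀ + z B₁`, computed along one fixed circle, is holomorphic
in `z` as long as the circle encircles the spectrum. -/
theorem differentiableAt_circleIntegral_kron [CompleteSpace F]
    (hK : DifferentiableOn ℂ K (halfPlane σ)) (B₀ B₁ : Matrix (Fin m) (Fin m) ℂ) {z : ℂ}
    {c : ℂ × ℝ} (hc : Encircles σ (B₀ + z • B₁) c) :
    DifferentiableAt ℂ (fun z => ∮ l in C(c.1, c.2),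
      kron ((l • (1 : Matrix (Fin m) (Fin m) ℂ) - (B₀ + z • B₁))⁻¹) (K l)) z := by
  set R : ℂ × ℂ → Matrix (Fin m) (Fin m) ℂ := fun q => q.2 • 1 - (B₀ + q.1 • B₁) with hR
  have hRsmooth : ContDiff ℂ 1 R := by fun_prop
  refine differentiableAt_circleIntegral
    (f := fun q => kron (R q)⁻¹ (K q.2))
    (W := {q | q.2 ∈ halfPlane σ} ∩ R ⁻¹' {A | IsUnit A}) ?_ ?_ hc.1.le ?_
  · exact ((isOpen_halfPlane σ).preimage continuous_snd).inter
      (Units.isOpen.preimage hRsmooth.continuous)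
  · simp only [kron_eq_sum]
    refine ContDiffOn.sum fun i _ => ContDiffOn.sum fun j _ => ContDiffOn.fun_smul ?_ ?_
    · have hinv : ∀ q ∈ {q | q.2 ∈ halfPlane σ} ∩ R ⁻¹' {A | IsUnit A},
          ContDiffWithinAt ℂ 1 (fun q => (R q)⁻¹)
            ({q | q.2 ∈ halfPlane σ} ∩ R ⁻¹' {A | IsUnit A}) q := by
        rintro q ⟨-, A, hA⟩
        simp only [Matrix.nonsing_inv_eq_ringInverse]
        have h := contDiffAt_ringInverse ℂ (n := 1) A
        rw [hA] at h
        exact (h.comp q hRsmooth.contDiffAt).contDiffWithinAt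
      exact (LinearMap.toContinuousLinearMap
        (Matrix.entryLinearMap ℂ ℂ i j)).contDiff.comp_contDiffOn hinv
    · refine (entryMap E F i j).contDiff.comp_contDiffOn ?_
      exact (hK.contDiffOn (isOpen_halfPlane σ)).comp contDiff_snd.contDiffOn fun q hq => hq.1
  · intro l hl
    refine ⟨hc.2.1 (Metric.sphere_subset_closedBall hl), ?_⟩
    have hl' : l ∉ spectrum ℂ (B₀ + z • B₁) := fun h =>
      notMem_sphere_of_mem_ball (hc.2.2 h) hl
    rw [spectrum.notMem_iff, Algebra.algebraMap_eq_smul_one] at hl'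
    exact hl'

/-- Upper semicontinuity of the spectrum along a pencil. -/
theorem eventually_spectrum_subset (B₀ B₁ : Matrix (Fin m) (Fin m) ℂ) {U : Set ℂ} (hU : IsOpen U)
    (h : spectrum ℂ B₀ ⊆ U) : ∀ᶠ z in 𝓝 (0 : ℂ), spectrum ℂ (B₀ + z • B₁) ⊆ U := by
  have h1 := upperHemicontinuous_iff_forall_isOpen.mp
    (upperHemicontinuous_spectrum ℂ (Matrix (Fin m) (Fin m) ℂ)) B₀ U hU h
  have h2 : Tendsto (fun z : ℂ => B₀ + z • B₁) (𝓝 0) (𝓝 B₀) := by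
    have : Continuous fun z : ℂ => B₀ + z • B₁ := by fun_prop
    simpa using this.tendsto 0
  exact h2.eventually h1

variable {D : ℂ → Matrix (Fin m) (Fin m) ℂ} {h : ℝ}

/-- For an affine symbol `D`, the function `z ↦ K(D(z)/h)` is holomorphic near `0`, since near `0`
the circle chosen by the functional calculus may be replaced by one that does not depend on `z`. -/
theorem exists_differentiableOn_cqGenerating [CompleteSpace F]
    (hK : DifferentiableOn ℂ K (halfPlane σ)) {D₀ D₁ : Matrix (Fin m) (Fin m) ℂ}
    (hD : ∀ z, D z = D₀ + z • D₁) (hs : spectrum ℂ ((h : ℂ)⁻¹ • D 0) ⊆ halfPlane σ) :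
    ∃ r > 0, DifferentiableOn ℂ (cqGenerating σ K D h) (Metric.ball 0 r) ∧
      ∀ z ∈ Metric.ball (0 : ℂ) r, spectrum ℂ ((h : ℂ)⁻¹ • D z) ⊆ halfPlane σ := by
  have hB : ∀ z, (h : ℂ)⁻¹ • D z = (h : ℂ)⁻¹ • D₀ + z • ((h : ℂ)⁻¹ • D₁) := fun z => by
    rw [hD, smul_add, smul_comm]
  obtain ⟨c, hc⟩ := exists_encircles σ _ hs
  have hc2 := hc.2.2
  rw [hB, zero_smul, add_zero] at hc2
  obtain ⟨r, hr, hball⟩ := Metric.eventually_nhds_iff_ball.mp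
    (eventually_spectrum_subset _ ((h : ℂ)⁻¹ • D₁) Metric.isOpen_ball hc2)
  have henc : ∀ z ∈ Metric.ball (0 : ℂ) r,
      Encircles σ ((h : ℂ)⁻¹ • D₀ + z • ((h : ℂ)⁻¹ • D₁)) c := fun z hz =>
    ⟨hc.1, hc.2.1, hball z hz⟩
  refine ⟨r, hr, ?_, fun z hz => ?_⟩
  · refine DifferentiableOn.congr (fun z hz =>
      ((differentiableAt_circleIntegral_kron hK _ _ (henc z hz)).const_smul
        (2 * (Real.pi : ℂ) * Complex.I)⁻¹).differentiableWithinAt) fun z hz => ?_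
    rw [cqGenerating, hB, matFun_eq_of_encircles hK (henc z hz)]
    rfl
  · rw [hB]
    exact (hball z hz).trans (Metric.ball_subset_closedBall.trans hc.2.1)

theorem cqWellPosed_of_differentiableOn [CompleteSpace F] {r : ℝ} (hr : 0 < r)
    (hd : DifferentiableOn ℂ (cqGenerating σ K D h) (Metric.ball 0 r))
    (hs : ∀ z ∈ Metric.ball (0 : ℂ) r, spectrum ℂ ((h : ℂ)⁻¹ • D z) ⊆ halfPlane σ) :
    CQWellPosed σ K D h := by
  filter_upwards [Metric.ball_mem_nhds (0 : ℂ) hr] with z hz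
  refine ⟨hs z hz, ?_⟩
  have := Complex.hasSum_taylorSeries_on_ball hd hz
  simp only [sub_zero] at this
  simpa only [cqWeight, smul_comm (z ^ _)] using this

/-- Similar symbols have similar weights. -/
theorem cqWeight_conj [CompleteSpace F] {D' : ℂ → Matrix (Fin m) (Fin m) ℂ}
    {P Q : Matrix (Fin m) (Fin m) ℂ} {r : ℝ} (hr : 0 < r)
    (hd : DifferentiableOn ℂ (cqGenerating σ K D h) (Metric.ball 0 r))
    (heq : ∀ᶠ z in 𝓝 (0 : ℂ), cqGenerating σ K D' h z = conjCLM E F P Q (cqGenerating σ K D h z))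
    (n : ℕ) : cqWeight σ K D' h n = conjCLM E F P Q (cqWeight σ K D h n) := by
  have hcd : ContDiffAt ℂ n (cqGenerating σ K D h) 0 :=
    (hd.contDiffOn Metric.isOpen_ball).contDiffAt (Metric.ball_mem_nhds 0 hr)
  rw [cqWeight, cqWeight, map_smul, EventuallyEq.iteratedDeriv_eq n heq]
  congr 1
  rw [iteratedDeriv_eq_iteratedFDeriv, iteratedDeriv_eq_iteratedFDeriv]
  have := (conjCLM E F P Q).iteratedFDeriv_comp_left hcd le_rfl
  rw [Function.comp_def] at this
  rw [this]
  rfl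

end Weights

/-! ### Interpolation -/

section Interpolation

variable {E : Type*} [NormedAddCommGroup E] [NormedSpace ℂ E] {p : ℕ} (φ : PolyBasis p)

theorem elemIndex_eq {h τ : ℝ} (hh : 0 < h) (n : ℕ) (hτ0 : 0 < τ) (hτ1 : τ ≤ 1) :
    elemIndex h (n * h + h * τ) = n := by
  have h1 : (n * h + h * τ) / h = n + τ := by field_simp
  have h2 : ⌈(n : ℝ) + τ⌉₊ = n + 1 := by
    rw [Nat.ceil_eq_iff n.succ_ne_zero]
    push_cast
    constructor <;> simp <;> linarith
  rw [elemIndex, h1, h2, Nat.add_sub_cancel]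

theorem div_sub_elemIndex {h τ : ℝ} (hh : 0 < h) (n : ℕ) (hτ0 : 0 < τ) (hτ1 : τ ≤ 1) :
    (n * h + h * τ) / h - elemIndex h (n * h + h * τ) = τ := by
  rw [elemIndex_eq hh n hτ0 hτ1]
  field_simp
  ring

theorem kron_mul_id_apply (A B : Matrix (Fin (p + 1)) (Fin (p + 1)) ℂ) (v : Fin (p + 1) → E) :
    kron (A * B) (ContinuousLinearMap.id ℂ E) v =
      kron A (ContinuousLinearMap.id ℂ E) (kron B (ContinuousLinearMap.id ℂ E) v) := by
  have := congrArg (· v)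
    (kron_mul_comp A B (ContinuousLinearMap.id ℂ E) (ContinuousLinearMap.id ℂ E))
  simpa using this

/-- An invertible real matrix acts injectively on vectors with entries in a complex vector space. -/
theorem eq_of_sum_smul_eq {A : Matrix (Fin (p + 1)) (Fin (p + 1)) ℝ} (hA : IsUnit A)
    {c d : Fin (p + 1) → E} (h : ∀ i, ∑ j, (A i j : ℂ) • c j = ∑ j, (A i j : ℂ) • d j) :
    c = d := by
  have h' : kron (complexify _ A) (ContinuousLinearMap.id ℂ E) c =
      kron (complexify _ A) (ContinuousLinearMap.id ℂ E) d := by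
    ext i
    simpa [kron_apply, complexify] using h i
  have hinv : complexify _ A⁻¹ * complexify _ A = 1 := by
    rw [← map_mul, Matrix.nonsing_inv_mul _ ((Matrix.isUnit_iff_isUnit_det _).mp hA), map_one]
  have h'' := congrArg (kron (complexify _ A⁻¹) (ContinuousLinearMap.id ℂ E)) h'
  rwa [← kron_mul_id_apply, ← kron_mul_id_apply, hinv, kron_one_id] at h''

/-- The matrix of the functionals that determine the projection `𝓘_p`: evaluation at `1` in row `0`
and the moments `P ↦ ∫_0^1 τ^k P(τ)`, `k < p`, in the rows below. -/
noncomputable def momentMatrix : Matrix (Fin (p + 1)) (Fin (p + 1)) ℝ :=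
  Matrix.of fun i j => Fin.cases (motive := fun _ => ℝ) (bval φ j 1)
    (fun k : Fin p => unitIntegral (X ^ (k : ℕ) * (φ j : ℝ[X]))) i

/-- A polynomial `(X - 1) s` of degree at most `p` that is orthogonal to all polynomials of degree
at most `p - 1` is orthogonal to `s`, hence zero. -/
theorem eq_zero_of_orthogonal {P : ℝ[X]} (hP : P ∈ degreeLT ℝ (p + 1)) (h1 : P.eval 1 = 0)
    (horth : ∀ k < p, unitIntegral (X ^ k * P) = 0) : P = 0 := by
  obtain ⟨s, hs⟩ := dvd_iff_isRoot.mpr h1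
  by_contra hne
  have hs0 : s ≠ 0 := by rintro rfl; simp at hs; exact hne hs
  have hsdeg : s.natDegree < p := by
    rw [mem_degreeLT, hs, degree_mul, degree_X_sub_C, degree_eq_natDegree hs0] at hP
    norm_cast at hP
    omega
  have hint : unitIntegral (s * P) = 0 := by
    rw [s.as_sum_range' p hsdeg, Finset.sum_mul, map_sum]
    refine Finset.sum_eq_zero fun k hk => ?_
    rw [← C_mul_X_pow_eq_monomial, mul_assoc, ← smul_eq_C_mul, map_smul,
      horth k (Finset.mem_range.mp hk), smul_zero]
  have hpos := unitIntegral_pos (P := -(s * P))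
    (neg_ne_zero.mpr (mul_ne_zero hs0 hne)) fun x _ hx1 => by
      rw [hs]
      simp only [eval_neg, eval_mul, eval_sub, eval_X, eval_C]
      have : 0 ≤ (1 - x) * s.eval x ^ 2 := mul_nonneg (by linarith) (sq_nonneg _)
      linarith
  rw [map_neg, hint, neg_zero] at hpos
  exact lt_irrefl _ hpos

theorem isUnit_momentMatrix : IsUnit (momentMatrix φ) := by
  refine isUnit_of_mulVec_eq_zero fun c hc => eq_zero_of_polyOfCoeff_eq_zero φ ?_
  refine eq_zero_of_orthogonal (polyOfCoeff_mem φ c) ?_ fun k hk => ?_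
  · rw [eval_polyOfCoeff]
    exact congrFun hc 0
  · have h := congrFun hc (Fin.succ ⟨k, hk⟩)
    rw [polyOfCoeff, Finset.mul_sum, map_sum]
    refine Eq.trans (Finset.sum_congr rfl fun j _ => ?_) h
    rw [mul_smul_comm, map_smul, smul_eq_mul, mul_comm]
    rfl

theorem integral_smul_sum_bval [CompleteSpace E] (q : ℝ[X]) (c : Fin (p + 1) → E) :
    ∫ τ in (0 : ℝ)..1, ((q.eval τ : ℝ) : ℂ) • ∑ j, (bval φ j τ : ℂ) • c j =
      ∑ j, (unitIntegral (q * (φ j : ℝ[X])) : ℂ) • c j := by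
  simp only [Finset.smul_sum, smul_smul, ← Complex.ofReal_mul]
  have hcont : ∀ j, Continuous fun τ => ((q.eval τ * bval φ j τ : ℝ) : ℂ) := fun j =>
    Complex.continuous_ofReal.comp (q.continuous.mul (φ j : ℝ[X]).continuous)
  have hint : ∀ j, IntervalIntegrable (fun τ => ((q.eval τ * bval φ j τ : ℝ) : ℂ) • c j)
      MeasureTheory.volume 0 1 := fun j =>
    ((hcont j).smul continuous_const).intervalIntegrable _ _
  rw [intervalIntegral.integral_finsetSum fun j _ => hint j]
  refine Finset.sum_congr rfl fun j _ => ?_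
  rw [intervalIntegral.integral_smul_const, intervalIntegral.integral_ofReal]
  simp [unitIntegral, bval]

theorem IsDGInterpCoeff.unique [CompleteSpace E] {h : ℝ} {u : ℝ → E} {n : ℕ}
    {c d : Fin (p + 1) → E} (hc : IsDGInterpCoeff φ h u n c) (hd : IsDGInterpCoeff φ h u n d) :
    c = d := by
  refine eq_of_sum_smul_eq (isUnit_momentMatrix φ) fun i => ?_
  refine Fin.cases ?_ (fun k => ?_) i
  · exact hc.1.trans hd.1.symm
  · have hk : (X ^ (k : ℕ) : ℝ[X]) ∈ degreeLT ℝ p := by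
      rw [mem_degreeLT, degree_X_pow]
      exact_mod_cast k.2
    have := (hc.2 _ hk).trans (hd.2 _ hk).symm
    rw [integral_smul_sum_bval, integral_smul_sum_bval] at this
    exact this

/-- The columns of the inverse node matrix hold the coefficients of the Lagrange polynomials. -/
theorem sum_bval_mul_nodeMatrix_inv (k : Fin (p + 1)) (τ : ℝ) :
    ∑ j, bval φ j τ * (nodeMatrix φ)⁻¹ j k = (radauLagrange p k).eval τ := by
  rw [← eval_polyOfCoeff φ (fun j => (nodeMatrix φ)⁻¹ j k)]
  congr 1
  refine eq_of_eval_radauNode_eq (polyOfCoeff_mem φ _) (radauLagrange_mem_degreeLT p k) fun i => ?_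
  rw [radauLagrange_eval_node, eval_polyOfCoeff, ← Matrix.one_apply, ← nodeMatrix_mul_inv φ]
  rfl

/-- The coefficients of the Radau interpolant on the element `(t_n, t_{n+1}]`. -/
noncomputable def radauCoeff (h : ℝ) (g : ℝ → E) (n : ℕ) : Fin (p + 1) → E :=
  kron (complexify _ (nodeMatrix φ)⁻¹) (ContinuousLinearMap.id ℂ E)
    (fun i => g (n * h + h * radauNode p i))

theorem sum_bval_smul_radauCoeff {h : ℝ} (hh : 0 < h) (g : ℝ → E) (n : ℕ) {τ : ℝ} (hτ0 : 0 < τ)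
    (hτ1 : τ ≤ 1) : ∑ j, (bval φ j τ : ℂ) • radauCoeff φ h g n j =
      radauInterp p h g (n * h + h * τ) := by
  rw [radauInterp, div_sub_elemIndex hh n hτ0 hτ1, elemIndex_eq hh n hτ0 hτ1]
  simp only [radauCoeff, kron_apply, Finset.smul_sum, smul_smul, ContinuousLinearMap.id_apply]
  rw [Finset.sum_comm]
  refine Finset.sum_congr rfl fun k _ => ?_
  rw [← Finset.sum_smul, ← sum_bval_mul_nodeMatrix_inv φ k τ]
  simp [complexify]

theorem isDGInterpCoeff_radauCoeff {h : ℝ} (hh : 0 < h) (g : ℝ → E) (n : ℕ) :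
    IsDGInterpCoeff φ h (radauInterp p h g) n (radauCoeff φ h g n) := by
  refine ⟨?_, fun q _ => ?_⟩
  · rw [sum_bval_smul_radauCoeff φ hh g n one_pos le_rfl, mul_one]
  · refine intervalIntegral.integral_congr_ae (Eventually.of_forall fun τ hτ => ?_)
    rw [Set.uIoc_of_le zero_le_one] at hτ
    rw [sum_bval_smul_radauCoeff φ hh g n hτ.1 hτ.2]

/-- The projection `𝓘_p` reproduces the Radau interpolant, a polynomial of degree at most `p` on
each element. -/
theorem dgInterpCoeff_radauInterp [CompleteSpace E] {h : ℝ} (hh : 0 < h) (g : ℝ → E) (n : ℕ) :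
    dgInterpCoeff φ h (radauInterp p h g) n = radauCoeff φ h g n :=
  IsDGInterpCoeff.unique φ (Classical.epsilon_spec ⟨_, isDGInterpCoeff_radauCoeff φ hh g n⟩)
    (isDGInterpCoeff_radauCoeff φ hh g n)

theorem piecewisePoly_eval_node {h : ℝ} (hh : 0 < h) (V : ℕ → Fin (p + 1) → E) (n : ℕ)
    (i : Fin (p + 1)) : piecewisePoly φ h V (n * h + h * radauNode p i) =
      kron (complexify _ (nodeMatrix φ)) (ContinuousLinearMap.id ℂ E) (V n) i := by
  have h0 := radauNode_pos p i
  have h1 := radauNode_le_one p i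
  rw [piecewisePoly, div_sub_elemIndex hh n h0 h1, elemIndex_eq hh n h0 h1, kron_apply]
  simp [complexify, nodeMatrix]

end Interpolation

end PCQ

/-! ### Equality of the two methods -/

theorem mainTheorem11 {𝒳 𝒴 : Type*}
    [NormedAddCommGroup 𝒳] [NormedSpace ℂ 𝒳] [CompleteSpace 𝒳]
    [NormedAddCommGroup 𝒴] [NormedSpace ℂ 𝒴] [CompleteSpace 𝒴]
    (σ : ℝ) (hσ : 0 ≤ σ) (K : ℂ → 𝒳 →L[ℂ] 𝒴)
    (hK : DifferentiableOn ℂ K (PCQ.halfPlane σ))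
    (hKbound : ∃ μ C : ℝ, ∀ s ∈ PCQ.halfPlane σ, ‖K s‖ ≤ C * ‖s‖ ^ μ)
    (p : ℕ) (φ : PCQ.PolyBasis p)
    (h : ℝ) (hh : 0 < h) (hsmall : 2 * σ * h < 1) (g : ℝ → 𝒳) :
    PCQ.CQWellPosed σ K (PCQ.dgSymbol φ) h ∧
    PCQ.CQWellPosed σ K (PCQ.rkSymbol p) h ∧
    ∀ (n : ℕ) (i : Fin (p + 1)),
      PCQ.pCQ φ σ K h (PCQ.radauInterp p h g) (n * h + h * PCQ.radauNode p i) =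
        PCQ.radauCQ p σ K h g n i := by
  have hspec : spectrum ℂ ((h : ℂ)⁻¹ • PCQ.dgSymbol φ 0) ⊆ PCQ.halfPlane σ := by
    intro l hl
    have hh0 : (h : ℂ) ≠ 0 := Complex.ofReal_ne_zero.mpr hh.ne'
    have hu : (h : ℂ) * l ∈ spectrum ℂ (PCQ.dgSymbol φ 0) := by
      have := spectrum.unit_smul_eq_smul (PCQ.dgSymbol φ 0) (Units.mk0 (h : ℂ) hh0)⁻¹
      change spectrum ℂ ((h : ℂ)⁻¹ • PCQ.dgSymbol φ 0) = _ at this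
      rw [this, Set.mem_smul_set] at hl
      obtain ⟨y, hy, rfl⟩ := hl
      change (h : ℂ) * ((h : ℂ)⁻¹ * y) ∈ _
      rwa [mul_inv_cancel_left₀ hh0]
    have hre := PCQ.half_le_re_of_mem_spectrum_dgSymbol_zero φ hu
    rw [Complex.re_ofReal_mul] at hre
    change σ < l.re
    -- Here `1/2 ≤ h Re l`, while `Re l ≤ σ` would give `h Re l ≤ h σ < 1/2`.
    by_contra! hcon
    nlinarith
  have haffine : ∀ z, PCQ.dgSymbol φ z = PCQ.dgSymbol φ 0 + z • -((PCQ.complexify _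
      (PCQ.massMatrix φ))⁻¹ * PCQ.complexify _ (PCQ.traceMatrix φ)) := fun z => by
    rw [PCQ.dgSymbol_eq, PCQ.dgSymbol_eq, zero_smul, sub_zero, Matrix.mul_sub, Matrix.mul_smul,
      smul_neg, sub_eq_add_neg]
  obtain ⟨r, hr, hd, hs⟩ := PCQ.exists_differentiableOn_cqGenerating hK haffine hspec
  set P := PCQ.complexify _ (PCQ.nodeMatrix φ) with hP
  set Q := PCQ.complexify _ (PCQ.nodeMatrix φ)⁻¹ with hQ
  have hPQ : P * Q = 1 := PCQ.complexify_nodeMatrix_mul_inv φ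
  have hrk : ∀ z ∈ Metric.ball (0 : ℂ) (min r 1), (h : ℂ)⁻¹ • PCQ.rkSymbol p z =
      P * ((h : ℂ)⁻¹ • PCQ.dgSymbol φ z) * Q := by
    intro z hz
    have hz1 : z ≠ 1 := by
      rintro rfl
      simp at hz
    rw [PCQ.rkSymbol_eq φ hz1, Matrix.mul_smul, Matrix.smul_mul]
  have hsub : Metric.ball (0 : ℂ) (min r 1) ⊆ Metric.ball 0 r :=
    Metric.ball_subset_ball (min_le_left _ _)
  have hr' : 0 < min r 1 := lt_min hr one_pos
  have hgen : ∀ z ∈ Metric.ball (0 : ℂ) (min r 1), PCQ.cqGenerating σ K (PCQ.rkSymbol p) h z =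
      PCQ.conjCLM 𝒳 𝒴 P Q (PCQ.cqGenerating σ K (PCQ.dgSymbol φ) h z) := fun z hz => by
    rw [PCQ.cqGenerating, hrk z hz, PCQ.matFun_conj hK hPQ (hs z (hsub hz))]
    rfl
  refine ⟨PCQ.cqWellPosed_of_differentiableOn hr hd hs,
    PCQ.cqWellPosed_of_differentiableOn hr' ?_ fun z hz => ?_, fun n i => ?_⟩
  · exact ((PCQ.conjCLM 𝒳 𝒴 P Q).differentiable.comp_differentiableOn (hd.mono hsub)).congr hgen
  · rw [hrk z hz, PCQ.spectrum_conj hPQ]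
    exact hs z (hsub hz)
  -- The weights of the two methods differ by passing between coefficients and node values, and so
  -- do the coefficients of the Radau interpolant and the stage values of `g`.
  · have hweight := PCQ.cqWeight_conj hr hd
      (Filter.eventually_of_mem (Metric.ball_mem_nhds 0 hr') hgen)
    rw [PCQ.pCQ, PCQ.piecewisePoly_eval_node φ hh, PCQ.radauCQ, PCQ.cqConv, PCQ.cqConv, map_sum]
    refine congrFun (Finset.sum_congr rfl fun j _ => ?_) i
    rw [hweight, PCQ.conjCLM_apply, PCQ.dgInterpCoeff_radauInterp φ hh]
    rfl
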